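/- Let $M$ be a compact oriented smooth Riemannian manifold without boundary, with Riemannian volume form $\mu$ normalized by $\mu(M)=1$. Let $\mathfrak D(M)$ be the group of orientation preserving smooth diffeomorphisms of $M$, let $\mathfrak D_\mu(M)=\{\eta\in\mathfrak D(M):\eta^*\mu=\mu\}$, and let $\mathrm{Dens}(M)=\mathfrak D_\mu(M)\backslash\mathfrak D(M)$ be the space of right cosets $[\xi]=\mathfrak D_\mu(M)\circ\xi$. For $\xi\in\mathfrak D(M)$ define $\mathrm{Jac}_\mu\xi$ by $\xi^*\mu=\mathrm{Jac}_\mu(\xi)\,\mu$. Tangent vectors of $\mathfrak D(M)$ at $\xi$ are the maps $v\circ\xi$ with $v$ a smooth vector field on $M$; a smooth curve $t\mapsto c_t$ in $\mathfrak D(M)$ is one for which $(t,x)\mapsto c_t(x)$ is smooth, and its velocity at time $t$ is $v\circ c_t$ if $\partial_t c_t(x)=v(c_t(x))$ for all $x$. The (degenerate, right-invariant) $\dot H^1$ metric on $\mathfrak D(M)$ is $$\langle v\circ\xi,w\circ\xi\rangle_{\dot H^1}=\tfrac14\int_M \mathrm{div}\,v\cdot\mathrm{div}\,w\,d\mu .$$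 The tangent space $T_{[\xi]}\mathrm{Dens}(M)$ is the quotient of $\{v\circ\xi\}$ by the tangent space $\{u\circ\xi:\mathrm{div}\,u=0\}$ of the coset. Then the following hold. 1. For every $\xi\in\mathfrak D(M)$ the function $\mathrm{Jac}_\mu\xi$ is positive, and for every smooth curve $t\mapsto c_t$ in $\mathfrak D(M)$ the function $(t,x)\mapsto\sqrt{\mathrm{Jac}_\mu c_t}(x)$ is smooth. In particular $\sqrt{\mathrm{Jac}_\mu\xi}\in C^\infty(M)$. 2. The $\dot H^1$ metric descends to a positive definite metric on $\mathrm{Dens}(M)$: it is well defined and positive definite on each $T_{[\xi]}\mathrm{Dens}(M)$, and if $c,c'$ and $b,b'$ are smooth curves in $\mathfrak D(M)$ with $[c_s]=[c'_s]$ and $[b_s]=[b'_s]$ for all $s$, and $c_t=b_t$, $c'_t=b'_t$, then the velocities at time $t$ satisfy $\langle\dot c,\dot b\rangle_{\dot H^1}=\langle\dot c',\dot b'\rangle_{\dot H^1}$. 3. The map $\xi\mapsto\sqrt{\mathrm{Jac}_\mu\xi}$ is constant on right cosets, and the induced map $\Psi:\mathrm{Dens}(M)\to L^2(M,\mu)$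 is injective with values in the unit sphere of $L^2(M,\mu)$. 4. $\Psi$ is an isometry from $\mathrm{Dens}(M)$ with the $\dot H^1$ metric to a subset of the unit sphere with the induced $L^2$ metric: for every $\xi\in\mathfrak D(M)$ there is a linear map $d\Psi:T_{[\xi]}\mathrm{Dens}(M)\to L^2(M,\mu)$, with values in the orthogonal complement of $\Psi([\xi])$, such that for every smooth curve $c$ in $\mathfrak D(M)$ with $c_t=\xi$ and velocity $v\circ\xi$ at time $t$ the curve $s\mapsto\Psi([c_s])$ is differentiable in $L^2(M,\mu)$ at $s=t$ with derivative $d\Psi[v\circ\xi]$, and $$\langle d\Psi X,d\Psi Y\rangle_{L^2}=\langle X,Y\rangle_{\dot H^1}\qquad\text{for all }X,Y\in T_{[\xi]}\mathrm{Dens}(M).$$ -/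

import Mathlib

open MeasureTheory Bundle
open scoped Manifold ContDiff Topology

noncomputable section

namespace SqrtMap

/-- The model space `ℝⁿ`. -/
abbrev Model (n : ℕ) : Type := EuclideanSpace ℝ (Fin n)

/-- The `i`-th coordinate vector of `ℝⁿ`. -/
def stdVec (n : ℕ) (i : Fin n) : Model n := EuclideanSpace.basisFun (Fin n) ℝ i

section Basic

variable {n : ℕ} {M : Type*} [TopologicalSpace M] [ChartedSpace (Model n) M]

instance instFactFinrankTangent (x : M) :
    Fact (Module.finrank ℝ (TangentSpace (𝓡 n) x) = n) :=
  ⟨finrank_euclideanSpace_fin (𝕜 := ℝ) (n := n)⟩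

/-- A field of exterior forms of top degree `n` on the `n`-manifold `M`. -/
abbrev TopForm (n : ℕ) (M : Type*) [TopologicalSpace M] [ChartedSpace (Model n) M] : Type _ :=
  ∀ x : M, (TangentSpace (𝓡 n) x) [⋀^Fin n]→ₗ[ℝ] ℝ

/-- The smooth vector fields on `M`. -/
abbrev VField (n : ℕ) (M : Type*) [TopologicalSpace M] [ChartedSpace (Model n) M]
    [IsManifold (𝓡 n) ∞ M] : Type _ :=
  ContMDiffSection (𝓡 n) (Model n) ∞ (fun x : M => TangentSpace (𝓡 n) x)

/-- The pullback `(f^*α)_x (v₁, …, vₙ) = α_{f x} (df_x v₁, …, df_x vₙ)`. -/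
def pullback (f : M → M) (α : TopForm n M) : TopForm n M := fun x =>
  (α (f x)).compLinearMap (mfderiv (𝓡 n) (𝓡 n) f x).toLinearMap

/-- The coefficient of `α` in the chart at `p`, that is the function `ρ` on the target of the chart
with `α = ρ dy₁ ∧ … ∧ dyₙ`; it is the value of `α` on the coordinate vectors `∂/∂yᵢ`. -/
def chartCoeff (α : TopForm n M) (p : M) (y : Model n) : ℝ :=
  α ((extChartAt (𝓡 n) p).symm y)
    (fun i => mfderiv (𝓡 n) (𝓡 n) (extChartAt (𝓡 n) p).symm y (stdVec n i))

/-- The measure `|ρ| dy` of the form `α = ρ dy₁ ∧ … ∧ dyₙ` on the domain of the chart at `p`,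
extended by zero to `M`. -/
def chartMeasure [MeasurableSpace M] (α : TopForm n M) (p : M) : Measure M :=
  (((volume : Measure (Model n)).restrict (extChartAt (𝓡 n) p).target).withDensity
    (fun y => ENNReal.ofReal |chartCoeff α p y|)).map (extChartAt (𝓡 n) p).symm

/-- The Borel measure of a form of top degree: by the change of variables formula the measures
`|ρ| dy` of two charts agree where the charts overlap, and their supremum is the measure on `M`
which restricts to `|ρ| dy` on the domain of each chart. -/
def formMeasure [MeasurableSpace M] (α : TopForm n M) : Measure M :=
  ⨆ p : M, chartMeasure α p

/-- The components of a vector field in the chart at `p`, as a function on the target of the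
chart. -/
def chartComp [IsManifold (𝓡 n) ∞ M] (v : VField n M) (p : M) : Model n → Model n :=
  VectorField.mpullback (𝓡 n) (𝓡 n) (extChartAt (𝓡 n) p).symm (fun x => v x)

/-- The divergence of `v` with respect to a volume form `μ`. With `μ = ρ dy₁ ∧ … ∧ dyₙ` and
`v = ∑ vⁱ ∂/∂yᵢ` in the chart at `x` it is
`ρ⁻¹ ∑ ∂(ρ vⁱ)/∂yᵢ = ∑ ∂vⁱ/∂yᵢ + ρ⁻¹ ∑ vⁱ ∂ρ/∂yᵢ`. -/
def divergence [IsManifold (𝓡 n) ∞ M] (μ : TopForm n M) (v : VField n M) (x : M) : ℝ :=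
  LinearMap.trace ℝ (Model n)
      (fderiv ℝ (chartComp v x) (extChartAt (𝓡 n) x x)).toLinearMap
    + fderiv ℝ (chartCoeff μ x) (extChartAt (𝓡 n) x x) (chartComp v x (extChartAt (𝓡 n) x x))
        / chartCoeff μ x (extChartAt (𝓡 n) x x)

/-- An orientation of `M`: an orientation of each tangent space, which is locally constant in the
local trivialisations of the tangent bundle given by the charts. -/
structure ManifoldOrientation (n : ℕ) (M : Type*) [TopologicalSpace M]
    [ChartedSpace (Model n) M] [IsManifold (𝓡 n) ∞ M] where
  orient : ∀ x : M, Orientation ℝ (TangentSpace (𝓡 n) x) (Fin n)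
  locallyConstant : ∀ p : M, ∃ o₀ : Orientation ℝ (Model n) (Fin n), ∀ᶠ x in 𝓝 p,
    ∀ hx : x ∈ (trivializationAt (Model n) (TangentSpace (𝓡 n) : M → Type _) p).baseSet,
      Orientation.map (Fin n)
        ((trivializationAt (Model n) (TangentSpace (𝓡 n) : M → Type _) p).linearEquivAt
          ℝ x hx) (orient x) = o₀

/-- Diffeomorphisms form a group under composition, `η * ξ = η ∘ ξ`. -/
instance instGroupDiffeomorph : Group (M ≃ₘ^∞⟮𝓡 n, 𝓡 n⟯ M) where
  mul η ξ := ξ.trans η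
  one := Diffeomorph.refl (𝓡 n) M ∞
  inv ξ := ξ.symm
  mul_assoc _ _ _ := rfl
  one_mul _ := rfl
  mul_one _ := rfl
  inv_mul_cancel ξ := ξ.self_trans_symm

theorem diffeo_mul_apply (η ξ : M ≃ₘ^∞⟮𝓡 n, 𝓡 n⟯ M) (x : M) : (η * ξ) x = η (ξ x) := rfl

theorem diffeo_one_apply (x : M) : (1 : M ≃ₘ^∞⟮𝓡 n, 𝓡 n⟯ M) x = x := rfl

theorem diffeo_mdiff (ξ : M ≃ₘ^∞⟮𝓡 n, 𝓡 n⟯ M) (x : M) :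
    MDifferentiableAt (𝓡 n) (𝓡 n) ξ x :=
  ξ.contMDiff.mdifferentiable (by simp) x

theorem mfderiv_diffeo_mul (η ξ : M ≃ₘ^∞⟮𝓡 n, 𝓡 n⟯ M) (x : M) :
    mfderiv (𝓡 n) (𝓡 n) (η * ξ) x
      = (mfderiv (𝓡 n) (𝓡 n) η (ξ x)).comp (mfderiv (𝓡 n) (𝓡 n) ξ x) :=
  mfderiv_comp x (diffeo_mdiff η (ξ x)) (diffeo_mdiff ξ x)

theorem mfderiv_diffeo_one (x : M) :
    mfderiv (𝓡 n) (𝓡 n) (1 : M ≃ₘ^∞⟮𝓡 n, 𝓡 n⟯ M) x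
      = ContinuousLinearMap.id ℝ (TangentSpace (𝓡 n) x) :=
  mfderiv_id

theorem pullback_mul (η ξ : M ≃ₘ^∞⟮𝓡 n, 𝓡 n⟯ M) (α : TopForm n M) :
    pullback (η * ξ) α = pullback ξ (pullback η α) := by
  funext x
  ext v
  simp only [pullback, AlternatingMap.compLinearMap_apply]
  rw [mfderiv_diffeo_mul]
  rfl

theorem pullback_one (α : TopForm n M) :
    pullback (1 : M ≃ₘ^∞⟮𝓡 n, 𝓡 n⟯ M) α = α := by
  funext x
  ext v
  simp only [pullback, AlternatingMap.compLinearMap_apply]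
  rw [mfderiv_diffeo_one]
  rfl

/-- The differential of a diffeomorphism at a point, as a linear equivalence. -/
def tangentEquiv (ξ : M ≃ₘ^∞⟮𝓡 n, 𝓡 n⟯ M) (x : M) :
    TangentSpace (𝓡 n) x ≃ₗ[ℝ] TangentSpace (𝓡 n) (ξ x) :=
  (ξ.mfderivToContinuousLinearEquiv (by simp) x).toLinearEquiv

theorem tangentEquiv_apply (ξ : M ≃ₘ^∞⟮𝓡 n, 𝓡 n⟯ M) (x : M) (v : TangentSpace (𝓡 n) x) :
    tangentEquiv ξ x v = mfderiv (𝓡 n) (𝓡 n) ξ x v := rfl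

variable [IsManifold (𝓡 n) ∞ M]

/-- `ξ` preserves the orientation `o`. -/
def PreservesOrientation (o : ManifoldOrientation n M) (ξ : M ≃ₘ^∞⟮𝓡 n, 𝓡 n⟯ M) : Prop :=
  ∀ x, Orientation.map (Fin n) (tangentEquiv ξ x) (o.orient x) = o.orient (ξ x)

theorem orientation_map_trans {V₁ V₂ V₃ : Type*} [AddCommGroup V₁] [Module ℝ V₁]
    [AddCommGroup V₂] [Module ℝ V₂] [AddCommGroup V₃] [Module ℝ V₃]
    (f : V₁ ≃ₗ[ℝ] V₂) (g : V₂ ≃ₗ[ℝ] V₃) (x : Orientation ℝ V₁ (Fin n)) :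
    Orientation.map (Fin n) (f.trans g) x
      = Orientation.map (Fin n) g (Orientation.map (Fin n) f x) := by
  induction x using Module.Ray.ind with
  | h v hv => rfl

theorem preservesOrientation_one (o : ManifoldOrientation n M) : PreservesOrientation o 1 := by
  intro x
  have h : tangentEquiv (1 : M ≃ₘ^∞⟮𝓡 n, 𝓡 n⟯ M) x
      = LinearEquiv.refl ℝ (TangentSpace (𝓡 n) x) := by
    ext v
    rw [tangentEquiv_apply, mfderiv_diffeo_one]
    rfl
  rw [h]
  exact congrFun (congrArg _ (Orientation.map_refl ..)) _

theorem preservesOrientation_mul {o : ManifoldOrientation n M} {η ξ : M ≃ₘ^∞⟮𝓡 n, 𝓡 n⟯ M}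
    (hη : PreservesOrientation o η) (hξ : PreservesOrientation o ξ) :
    PreservesOrientation o (η * ξ) := by
  intro x
  have h : tangentEquiv (η * ξ) x = (tangentEquiv ξ x).trans (tangentEquiv η (ξ x)) := by
    ext v
    rw [tangentEquiv_apply, mfderiv_diffeo_mul]
    rfl
  rw [h]
  refine (orientation_map_trans _ _ _).trans ?_
  rw [hξ x]
  exact hη (ξ x)

theorem preservesOrientation_inv {o : ManifoldOrientation n M} {ξ : M ≃ₘ^∞⟮𝓡 n, 𝓡 n⟯ M}
    (hξ : PreservesOrientation o ξ) : PreservesOrientation o ξ⁻¹ := by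
  intro x
  have h1 : PreservesOrientation o (ξ * ξ⁻¹) := by
    rw [mul_inv_cancel]
    exact preservesOrientation_one o
  have h2 : tangentEquiv (ξ * ξ⁻¹) x = (tangentEquiv ξ⁻¹ x).trans (tangentEquiv ξ (ξ⁻¹ x)) := by
    ext v
    rw [tangentEquiv_apply, mfderiv_diffeo_mul]
    rfl
  have h3 := h1 x
  rw [h2] at h3
  exact (Orientation.map (Fin n) (tangentEquiv ξ (ξ⁻¹ x))).injective
    ((orientation_map_trans _ _ _).symm.trans (h3.trans (hξ (ξ⁻¹ x)).symm))

/-- The group `𝔇(M)` of orientation preserving smooth diffeomorphisms of `M`. -/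
def Diff (o : ManifoldOrientation n M) : Subgroup (M ≃ₘ^∞⟮𝓡 n, 𝓡 n⟯ M) where
  carrier := {ξ | PreservesOrientation o ξ}
  mul_mem' := preservesOrientation_mul
  one_mem' := preservesOrientation_one o
  inv_mem' := preservesOrientation_inv

theorem chartComp_differentiable (v : VField n M) (x : M) :
    DifferentiableAt ℝ (chartComp v x) (extChartAt (𝓡 n) x x) := by
  have h := VectorField.contMDiffWithinAt_mpullbackWithin_extChartAt_symm
    (s := Set.univ) (m := 1) (n := ∞) (v.contMDiff.contMDiffAt (x := x).of_le (by simp))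
    uniqueMDiffOn_univ (Set.mem_univ x) (by norm_cast)
  have h' := contMDiffWithinAt_vectorSpace_iff_contDiffWithinAt.1 h
  simp only [Set.preimage_univ, Set.inter_univ, modelWithCornersSelf_coe, Set.range_id,
    VectorField.mpullbackWithin_univ] at h'
  exact (h'.contDiffAt (extChartAt_target_mem_nhds x)).differentiableAt (by simp)

theorem chartComp_add (v w : VField n M) (x : M) :
    chartComp (v + w) x = chartComp v x + chartComp w x :=
  VectorField.mpullback_add ..

theorem chartComp_smul (c : ℝ) (v : VField n M) (x : M) :
    chartComp (c • v) x = c • chartComp v x :=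
  VectorField.mpullback_const_smul ..

theorem divergence_add (μ : TopForm n M) (v w : VField n M) (x : M) :
    divergence μ (v + w) x = divergence μ v x + divergence μ w x := by
  simp only [divergence, chartComp_add]
  rw [fderiv_add (chartComp_differentiable v x) (chartComp_differentiable w x)]
  simp only [Pi.add_apply, map_add, ContinuousLinearMap.toLinearMap_add, add_div]
  ring

theorem divergence_smul (μ : TopForm n M) (c : ℝ) (v : VField n M) (x : M) :
    divergence μ (c • v) x = c * divergence μ v x := by
  simp only [divergence, chartComp_smul]
  rw [fderiv_const_smul (chartComp_differentiable v x)]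
  simp only [Pi.smul_apply, map_smul, ContinuousLinearMap.toLinearMap_smul, smul_eq_mul]
  ring

/-- The space `T_e 𝔇_μ(M)` of the divergence free vector fields. -/
def DivFree (μ : TopForm n M) : Submodule ℝ (VField n M) where
  carrier := {v | ∀ x, divergence μ v x = 0}
  add_mem' := by
    intro v w hv hw x
    rw [divergence_add, hv x, hw x, add_zero]
  zero_mem' := by
    intro x
    have h := divergence_smul μ 0 0 x
    rwa [zero_smul, zero_mul] at h
  smul_mem' := by
    intro c v hv x
    rw [divergence_smul, hv x, mul_zero]

end Basic

section Riemannian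

variable {n : ℕ} {M : Type*} [TopologicalSpace M] [ChartedSpace (Model n) M]
  [IsManifold (𝓡 n) ∞ M] [RiemannianBundle (fun x : M => TangentSpace (𝓡 n) x)]

/-- The Riemannian volume form `μ` of an oriented Riemannian manifold. -/
def volForm (o : ManifoldOrientation n M) : TopForm n M := fun x => (o.orient x).volumeForm

/-- The Riemannian volume measure. -/
def vol [MeasurableSpace M] (o : ManifoldOrientation n M) : Measure M := formMeasure (volForm o)

/-- The group `𝔇_μ(M)` of volume preserving diffeomorphisms. -/
def VolDiff (o : ManifoldOrientation n M) : Subgroup (Diff o) where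
  carrier := {η | pullback (η : M ≃ₘ^∞⟮𝓡 n, 𝓡 n⟯ M) (volForm o) = volForm o}
  mul_mem' := by
    intro η ξ hη hξ
    change pullback ((η : M ≃ₘ^∞⟮𝓡 n, 𝓡 n⟯ M) * (ξ : M ≃ₘ^∞⟮𝓡 n, 𝓡 n⟯ M) :) (volForm o) = volForm o
    rw [pullback_mul, hη, hξ]
  one_mem' := pullback_one _
  inv_mem' := by
    intro ξ hξ
    change pullback ((ξ : M ≃ₘ^∞⟮𝓡 n, 𝓡 n⟯ M)⁻¹ :) (volForm o) = volForm o
    have h := pullback_mul (ξ : M ≃ₘ^∞⟮𝓡 n, 𝓡 n⟯ M) (ξ : M ≃ₘ^∞⟮𝓡 n, 𝓡 n⟯ M)⁻¹ (volForm o)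
    rw [mul_inv_cancel, pullback_one, hξ] at h
    exact h.symm

/-- The space `Dens(M) = 𝔇_μ(M) \ 𝔇(M)` of right cosets `𝔇_μ(M) ∘ ξ`. -/
abbrev Dens (o : ManifoldOrientation n M) : Type _ :=
  Quotient (QuotientGroup.rightRel (VolDiff o))

/-- The coset of `ξ`. -/
abbrev Dens.proj (o : ManifoldOrientation n M) (ξ : Diff o) : Dens o :=
  Quotient.mk (QuotientGroup.rightRel (VolDiff o)) ξ

theorem Dens.proj_eq_iff (o : ManifoldOrientation n M) (ξ ζ : Diff o) :
    Dens.proj o ξ = Dens.proj o ζ ↔ ∃ η ∈ VolDiff o, ζ = η * ξ := by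
  rw [Quotient.eq, QuotientGroup.rightRel_apply]
  constructor
  · intro h
    exact ⟨_, h, by group⟩
  · rintro ⟨η, hη, rfl⟩
    simpa using hη

/-- The Jacobian of `ξ` with respect to `μ`, that is the function with `ξ^*μ = Jac_μ(ξ) μ`. -/
def jac (o : ManifoldOrientation n M) (ξ : M → M) (x : M) : ℝ :=
  pullback ξ (volForm o) x (stdVec n) / volForm o x (stdVec n)

theorem pullback_volForm (o : ManifoldOrientation n M) (ξ : M → M) (x : M) :
    pullback ξ (volForm o) x = jac o ξ x • volForm o x := by
  let b : Module.Basis (Fin n) ℝ (TangentSpace (𝓡 n) x) :=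
    (EuclideanSpace.basisFun (Fin n) ℝ).toBasis
  have : FiniteDimensional ℝ (TangentSpace (𝓡 n) x) := Module.Finite.of_basis b
  have hb : (stdVec n : Fin n → TangentSpace (𝓡 n) x) = b := by
    funext i
    exact (congrFun (EuclideanSpace.basisFun (Fin n) ℝ).coe_toBasis i).symm
  have h1 := AlternatingMap.eq_smul_basis_det b (pullback ξ (volForm o) x)
  have h2 := AlternatingMap.eq_smul_basis_det b (volForm o x)
  have h0 : volForm o x b ≠ 0 := by
    intro h
    rw [h, zero_smul] at h2
    have h3 := (o.orient x).abs_volumeForm_apply_of_orthonormal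
      ((stdOrthonormalBasis ℝ (TangentSpace (𝓡 n) x)).reindex (finCongr Fact.out))
    change |volForm o x _| = 1 at h3
    rw [h2] at h3
    simp at h3
  rw [jac, hb, h2, smul_smul, ← h2, div_mul_cancel₀ _ h0]
  exact h1

/-- Smooth curves `t ↦ c t` in `𝔇(M)`: the map `(t, x) ↦ c t x` is smooth. -/
def IsSmoothCurve {o : ManifoldOrientation n M} (c : ℝ → Diff o) : Prop :=
  ContMDiff (𝓘(ℝ, ℝ).prod (𝓡 n)) (𝓡 n) ∞
    (fun p : ℝ × M => (c p.1 : M ≃ₘ^∞⟮𝓡 n, 𝓡 n⟯ M) p.2)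

/-- The curve `c` in `𝔇(M)` has at time `t` the velocity `v ∘ c t ∈ T_{c t} 𝔇(M)`. -/
def HasVelocity {o : ManifoldOrientation n M} (c : ℝ → Diff o) (t : ℝ) (v : VField n M) : Prop :=
  ∀ x : M, HasMFDerivAt 𝓘(ℝ, ℝ) (𝓡 n) (fun s : ℝ => (c s : M ≃ₘ^∞⟮𝓡 n, 𝓡 n⟯ M) x) t
    ((1 : ℝ →L[ℝ] ℝ).smulRight (v ((c t : M ≃ₘ^∞⟮𝓡 n, 𝓡 n⟯ M) x)))

/-- The degenerate `Ḣ¹` metric on `𝔇(M)`: the product of the tangent vectors `v ∘ ξ` and `w ∘ ξ`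
at any `ξ ∈ 𝔇(M)`. -/
def hdot [MeasurableSpace M] (o : ManifoldOrientation n M) (v w : VField n M) : ℝ :=
  (1 / 4) * ∫ x, divergence (volForm o) v x * divergence (volForm o) w x ∂(vol o)

/-- The tangent space of `Dens(M)` at the coset of `ξ`: the quotient of
`T_ξ 𝔇(M) = {v ∘ ξ}` by the tangent space `{u ∘ ξ | div u = 0}` of the coset, written in terms of
`v`. -/
abbrev DensTangent (o : ManifoldOrientation n M) : Type _ := VField n M ⧸ DivFree (volForm o)

/-- The projection `T_ξ 𝔇(M) → T_{[ξ]} Dens(M)`. -/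
abbrev DensTangent.proj (o : ManifoldOrientation n M) : VField n M →ₗ[ℝ] DensTangent o :=
  (DivFree (volForm o)).mkQ

theorem divergence_congr (o : ManifoldOrientation n M) {v v' : VField n M}
    (h : (DivFree (volForm o)).quotientRel v v') (x : M) :
    divergence (volForm o) v x = divergence (volForm o) v' x := by
  rw [Submodule.quotientRel_def] at h
  have h1 := divergence_add (volForm o) (v - v') v' x
  rw [sub_add_cancel, h x, zero_add] at h1
  exact h1

/-- The `Ḣ¹` metric on the tangent space of `Dens(M)` at a coset. -/
def hdotDens [MeasurableSpace M] (o : ManifoldOrientation n M) : DensTangent o → DensTangent o → ℝ :=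
  Quotient.lift₂ (hdot o) (by
    intro v w v' w' hv hw
    simp only [hdot, divergence_congr o hv, divergence_congr o hw])

end Riemannian

end SqrtMap

end

open SqrtMap

/-! Everything rests on two facts about the Jacobian J of ξ. It is a cocycle, Jac(η ∘ ξ) = (Jac η ∘
ξ) · Jac ξ, and it is identically 1 exactly on the volume preserving maps. So J is a complete
invariant of the right coset (`proj_eq_iff_jac_eq`), which makes √J well defined and injective on
Dens(M). Along a curve through ξ with velocity v ∘ ξ it satisfies Liouville's formula dJ/dt = (div v
∘ ξ) · J (`hasDerivAt_jac`), whence d√J/dt = ½ √J · (div v ∘ ξ).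

A product of two expressions of the type √J or d√J/dt carries one factor J, which the change of
variables ∫ (g ∘ ξ) J dμ = ∫ g dμ (`integral_comp_mul_jac`) absorbs. Taking g = 1 gives the unit
norm. Taking g = ½ div v gives orthogonality to Ψ, by the divergence theorem. Taking g = div v · div
w, with ½ · ½ = ¼, gives the isometry.

The analysis is local. If μ = ρ dy in charts, J is a determinant times a quotient of values of ρ,
and Liouville's formula combines Jacobi's formula, the variational equation and the derivative of ρ.
Smoothness of ρ holds because ρ is ±√(det g) with a locally constant sign. Differentiability in L²
comes from differentiability in the sup norm on the compact M (`hasDerivAt_continuousMap`). -/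

noncomputable section

namespace SqrtMap

/-! ### Determinants: smoothness, Jacobi's formula, action on top forms. -/

section Determinant

/-- The determinant as a continuous multilinear function of the rows. -/
def detRows (n : ℕ) : ContinuousMultilinearMap ℝ (fun _ : Fin n => Fin n → ℝ) ℝ where
  toMultilinearMap := (Matrix.detRowAlternating (n := Fin n) (R := ℝ)).toMultilinearMap
  cont := Continuous.matrix_det continuous_id

variable {n : ℕ}

/-- The matrix of an endomorphism of `ℝⁿ`. -/
def matCLM (n : ℕ) : (Model n →L[ℝ] Model n) →L[ℝ] (Fin n → Fin n → ℝ) :=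
  LinearMap.toContinuousLinearMap
    ((LinearMap.toMatrix (EuclideanSpace.basisFun (Fin n) ℝ).toBasis
      (EuclideanSpace.basisFun (Fin n) ℝ).toBasis).toLinearMap ∘ₗ
        (ContinuousLinearMap.coeLM ℝ : (Model n →L[ℝ] Model n) →ₗ[ℝ] Model n →ₗ[ℝ] Model n))

theorem matCLM_apply (A : Model n →L[ℝ] Model n) :
    matCLM n A = LinearMap.toMatrix (EuclideanSpace.basisFun (Fin n) ℝ).toBasis
      (EuclideanSpace.basisFun (Fin n) ℝ).toBasis A.toLinearMap := rfl

theorem det_eq_detRows (A : Model n →L[ℝ] Model n) : A.det = detRows n (matCLM n A) := by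
  rw [ContinuousLinearMap.det, ← LinearMap.det_toMatrix (EuclideanSpace.basisFun (Fin n) ℝ).toBasis]
  rfl

theorem contDiff_det : ContDiff ℝ ∞ (fun A : Model n →L[ℝ] Model n => A.det) := by
  simp only [det_eq_detRows]
  exact (detRows n).contDiff.comp (matCLM n).contDiff

/-- Jacobi's formula for the derivative of the determinant. -/
theorem hasDerivAt_det {A : ℝ → Model n →L[ℝ] Model n} {B : Model n →L[ℝ] Model n} {t : ℝ}
    (h : HasDerivAt A (B.comp (A t)) t) :
    HasDerivAt (fun s => (A s).det) (LinearMap.trace ℝ (Model n) B.toLinearMap * (A t).det) t := by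
  have h1 := ((detRows n).hasFDerivAt (matCLM n (A t))).comp_hasDerivAt t
    ((matCLM n).hasFDerivAt.comp_hasDerivAt t h)
  simp only [det_eq_detRows]
  convert! h1 using 1
  rw [ContinuousMultilinearMap.linearDeriv_apply]
  rw [LinearMap.trace_eq_matrix_trace ℝ (EuclideanSpace.basisFun (Fin n) ℝ).toBasis, Matrix.trace,
    Finset.sum_mul]
  refine Finset.sum_congr rfl fun i _ => ?_
  -- Row i of BA combines the rows of A with coefficients from row i of B. Put in place of row i of
  -- A, only the multiple B i i of that row survives in the determinant; the sum over i is the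
  -- trace.
  have h2 : matCLM n (B.comp (A t)) i = ∑ k, matCLM n B i k • matCLM n (A t) k := by
    rw [matCLM_apply, ContinuousLinearMap.toLinearMap_comp,
      LinearMap.toMatrix_comp _ (EuclideanSpace.basisFun (Fin n) ℝ).toBasis]
    funext j
    simp [Matrix.mul_apply, matCLM_apply]
  rw [h2]
  exact (Matrix.det_updateRow_sum (matCLM n (A t)) i (matCLM n B i)).symm

theorem stdVec_eq_basis (n : ℕ) :
    stdVec n = (EuclideanSpace.basisFun (Fin n) ℝ).toBasis := by
  funext i
  exact (congrFun (EuclideanSpace.basisFun (Fin n) ℝ).coe_toBasis i).symm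

/-- Top forms are multiples of the determinant form of the standard basis, so it suffices to know
the effect of A on that form. -/
theorem alternating_comp_stdVec (β : (Model n) [⋀^Fin n]→ₗ[ℝ] ℝ) (A : Model n →L[ℝ] Model n) :
    β (fun i => A (stdVec n i)) = A.det * β (stdVec n) := by
  have h := AlternatingMap.eq_smul_basis_det (EuclideanSpace.basisFun (Fin n) ℝ).toBasis β
  have h2 := congrArg (fun γ => γ (fun i => A (stdVec n i))) h
  simp only [stdVec_eq_basis, AlternatingMap.smul_apply] at h2 ⊢
  rw [h2]
  have h3 := Module.Basis.det_comp (EuclideanSpace.basisFun (Fin n) ℝ).toBasis A.toLinearMap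
    (EuclideanSpace.basisFun (Fin n) ℝ).toBasis
  rw [Module.Basis.det_self, mul_one] at h3
  rw [smul_eq_mul, mul_comm]
  congr 1

end Determinant

/-! ### Coefficients of top forms and components of vector fields in charts. -/

section Charts

variable {n : ℕ} {M : Type*} [TopologicalSpace M] [ChartedSpace (Model n) M]

/-- The value of `α` on the coordinate vectors of a parametrisation `ψ`. -/
def paramCoeff (α : TopForm n M) (ψ : Model n → M) (y : Model n) : ℝ :=
  α (ψ y) (fun i => mfderiv (𝓡 n) (𝓡 n) ψ y (stdVec n i))

variable [IsManifold (𝓡 n) ∞ M]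

theorem contMDiffAt_chart_symm {p : M} {y : Model n} (hy : y ∈ (extChartAt (𝓡 n) p).target) :
    ContMDiffAt (𝓡 n) (𝓡 n) ∞ (extChartAt (𝓡 n) p).symm y :=
  (contMDiffOn_extChartAt_symm p).contMDiffAt ((isOpen_extChartAt_target p).mem_nhds hy)

theorem contMDiffAt_chart {p x : M} (hx : x ∈ (extChartAt (𝓡 n) p).source) :
    ContMDiffAt (𝓡 n) (𝓡 n) ∞ (extChartAt (𝓡 n) p) x :=
  contMDiffAt_extChartAt' (by simpa using hx)

theorem mdiffAt_chart_symm {p : M} {y : Model n} (hy : y ∈ (extChartAt (𝓡 n) p).target) :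
    MDifferentiableAt (𝓡 n) (𝓡 n) (extChartAt (𝓡 n) p).symm y :=
  (contMDiffAt_chart_symm hy).mdifferentiableAt (by simp)

theorem mdiffAt_chart {p x : M} (hx : x ∈ (extChartAt (𝓡 n) p).source) :
    MDifferentiableAt (𝓡 n) (𝓡 n) (extChartAt (𝓡 n) p) x :=
  (contMDiffAt_chart hx).mdifferentiableAt (by simp)

theorem mfderiv_chart_symm_comp {p : M} {y : Model n} (hy : y ∈ (extChartAt (𝓡 n) p).target) :
    (mfderiv (𝓡 n) (𝓡 n) (extChartAt (𝓡 n) p) ((extChartAt (𝓡 n) p).symm y)).comp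
      (mfderiv (𝓡 n) (𝓡 n) (extChartAt (𝓡 n) p).symm y) = ContinuousLinearMap.id _ _ := by
  have h := mfderiv_extChartAt_comp_mfderivWithin_extChartAt_symm (I := 𝓡 n) hy
  simpa using h

theorem mfderiv_chart_comp_symm {p : M} {y : Model n} (hy : y ∈ (extChartAt (𝓡 n) p).target) :
    (mfderiv (𝓡 n) (𝓡 n) (extChartAt (𝓡 n) p).symm y).comp
      (mfderiv (𝓡 n) (𝓡 n) (extChartAt (𝓡 n) p) ((extChartAt (𝓡 n) p).symm y)) =
        ContinuousLinearMap.id _ _ := by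
  have h := mfderivWithin_extChartAt_symm_comp_mfderiv_extChartAt (I := 𝓡 n) hy
  simpa using h

/-- The transformation of the coefficient of a form of top degree. -/
theorem paramCoeff_eq_det_mul (α : TopForm n M) {ψ : Model n → M} {y : Model n} {q : M}
    (hψ : MDifferentiableAt (𝓡 n) (𝓡 n) ψ y) (hq : ψ y ∈ (extChartAt (𝓡 n) q).source) :
    paramCoeff α ψ y =
      (fderiv ℝ (fun z => extChartAt (𝓡 n) q (ψ z)) y).det
        * chartCoeff α q (extChartAt (𝓡 n) q (ψ y)) := by
  have hH : MDifferentiableAt (𝓡 n) (𝓡 n) (fun z => extChartAt (𝓡 n) q (ψ z)) y :=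
    (mdiffAt_chart hq).comp y hψ
  have ht := (extChartAt (𝓡 n) q).map_source hq
  have hD := (mdiffAt_chart_symm ht).hasMFDerivAt.comp (I' := 𝓡 n) y hH.hasMFDerivAt
  -- Near y, ψ factors through the chart at q, so the chain rule splits its differential into a
  -- linear map of `ℝⁿ`, which yields the determinant, and the coordinate vectors of that chart.
  have he : ψ =ᶠ[𝓝 y] (extChartAt (𝓡 n) q).symm ∘ (fun z => extChartAt (𝓡 n) q (ψ z)) := by
    filter_upwards [hψ.continuousAt.preimage_mem_nhds
      ((isOpen_extChartAt_source q).mem_nhds hq)] with z hz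
    exact ((extChartAt (𝓡 n) q).left_inv hz).symm
  have h1 := (hD.congr_of_eventuallyEq he).mfderiv
  rw [mfderiv_eq_fderiv] at h1
  have h2 := alternating_comp_stdVec
    ((α (ψ y)).compLinearMap
      (mfderiv (𝓡 n) (𝓡 n) (extChartAt (𝓡 n) q).symm (extChartAt (𝓡 n) q (ψ y))).toLinearMap)
    (fderiv ℝ (fun z => extChartAt (𝓡 n) q (ψ z)) y)
  rw [paramCoeff, h1]
  refine Eq.trans h2 ?_
  rw [chartCoeff, (extChartAt (𝓡 n) q).left_inv hq]
  rfl

theorem chartCoeff_pullback (α : TopForm n M) (f : M → M) {p : M} {y : Model n}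
    (hy : y ∈ (extChartAt (𝓡 n) p).target)
    (hf : MDifferentiableAt (𝓡 n) (𝓡 n) f ((extChartAt (𝓡 n) p).symm y)) :
    chartCoeff (pullback f α) p y = paramCoeff α (fun z => f ((extChartAt (𝓡 n) p).symm z)) y := by
  have h := mfderiv_comp (I' := 𝓡 n) y hf (mdiffAt_chart_symm hy)
  change _ = α (f ((extChartAt (𝓡 n) p).symm y)) (fun i =>
    mfderiv (𝓡 n) (𝓡 n) (f ∘ (extChartAt (𝓡 n) p).symm) y (stdVec n i))
  rw [h]
  rfl

/-- The pullback of a field uses the inverse of the differential of the parametrisation; on the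
chart target this inverse is the differential of the chart. -/
theorem chartComp_apply (v : VField n M) {p : M} {y : Model n}
    (hy : y ∈ (extChartAt (𝓡 n) p).target) :
    chartComp v p y = mfderiv (𝓡 n) (𝓡 n) (extChartAt (𝓡 n) p) ((extChartAt (𝓡 n) p).symm y)
      (v ((extChartAt (𝓡 n) p).symm y)) := by
  rw [chartComp, VectorField.mpullback_apply,
    ContinuousLinearMap.inverse_eq (mfderiv_chart_comp_symm hy) (mfderiv_chart_symm_comp hy)]
  rfl

theorem chartComp_contDiffAt (v : VField n M) {p : M} {y : Model n}
    (hy : y ∈ (extChartAt (𝓡 n) p).target) :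
    ContDiffAt ℝ ∞ (chartComp v p) y := by
  have hinv : (mfderiv (𝓡 n) (𝓡 n) (extChartAt (𝓡 n) p).symm y).IsInvertible :=
    ContinuousLinearMap.IsInvertible.of_inverse (mfderiv_chart_comp_symm hy)
      (mfderiv_chart_symm_comp hy)
  have h := ContMDiffAt.mpullback_vectorField_preimage (m := ∞) (n := ∞)
    (I := 𝓡 n) (I' := 𝓡 n) (f := (extChartAt (𝓡 n) p).symm) (x₀ := y) (V := fun x => v x)
    (v.contMDiff.contMDiffAt) (contMDiffAt_chart_symm hy) hinv (by simp)
  exact (contMDiffAt_vectorSpace_iff_contDiffAt).1 h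

end Charts

/-! ### The volume form of an oriented inner product space. -/

section OrientedLinearAlgebra

variable {n : ℕ} {V : Type*} [NormedAddCommGroup V] [InnerProductSpace ℝ V]
  [FiniteDimensional ℝ V] [hn : Fact (Module.finrank ℝ V = n)]

/-- Both signs are kept instead of choosing an oriented basis, because in dimension 0 the empty
basis has a fixed orientation, which may be opposite to `o`. -/
theorem exists_orthonormalBasis_volumeForm (o : Orientation ℝ V (Fin n)) :
    ∃ b : OrthonormalBasis (Fin n) ℝ V, o.volumeForm = b.toBasis.det ∧ o = b.toBasis.orientation ∨
      o.volumeForm = -b.toBasis.det ∧ o = -b.toBasis.orientation := by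
  let b := (stdOrthonormalBasis ℝ V).reindex (finCongr hn.out)
  refine ⟨b, ?_⟩
  by_cases h : b.toBasis.orientation = o
  · exact Or.inl ⟨o.volumeForm_robust b h, h.symm⟩
  · refine Or.inr ⟨o.volumeForm_robust_neg b h, ?_⟩
    exact (b.toBasis.orientation_ne_iff_eq_neg o).1 (Ne.symm h)

theorem volumeForm_ne_zero (o : Orientation ℝ V (Fin n)) : o.volumeForm ≠ 0 := by
  obtain ⟨b, ⟨h, -⟩ | ⟨h, -⟩⟩ := exists_orthonormalBasis_volumeForm o
  · rw [h]
    exact b.toBasis.det_ne_zero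
  · rw [h]
    exact neg_ne_zero.2 b.toBasis.det_ne_zero

/-- This converts statements about orientations, which are rays of forms, into statements about
positive multiples of volume forms. -/
theorem rayOfNeZero_volumeForm (o : Orientation ℝ V (Fin n)) :
    rayOfNeZero ℝ o.volumeForm (volumeForm_ne_zero o) = o := by
  obtain ⟨b, ⟨h, h'⟩ | ⟨h, h'⟩⟩ := exists_orthonormalBasis_volumeForm o
  · conv_rhs => rw [h']
    simp only [h]
    rfl
  · conv_rhs => rw [h']
    simp only [h]
    rw [Module.Basis.orientation, neg_rayOfNeZero]

/-- If P is the matrix of `v` in an orthonormal basis, the volume form has absolute value |det P| on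
`v`, and the Gram matrix is PᵀP. -/
theorem volumeForm_sq_eq_det_gram (o : Orientation ℝ V (Fin n)) (v : Fin n → V) :
    o.volumeForm v ^ 2 = (Matrix.gram ℝ v).det := by
  obtain ⟨b, -⟩ := exists_orthonormalBasis_volumeForm o
  rw [← sq_abs, o.volumeForm_robust' b v, sq_abs, Matrix.gram_eq_conjTranspose_mul b,
    Matrix.det_mul, Matrix.det_conjTranspose, Module.Basis.det_apply, sq]
  rfl

end OrientedLinearAlgebra

theorem sameRay_volumeForm_of_map_eq {n : ℕ} {V W : Type*} [NormedAddCommGroup V]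
    [InnerProductSpace ℝ V] [FiniteDimensional ℝ V] [Fact (Module.finrank ℝ V = n)] [AddCommGroup W]
    [Module ℝ W] (e : V ≃ₗ[ℝ] W)
    (o : Orientation ℝ V (Fin n)) (β : W [⋀^Fin n]→ₗ[ℝ] ℝ) (hβ : β ≠ 0)
    (h : Orientation.map (Fin n) e o = rayOfNeZero ℝ β hβ) :
    SameRay ℝ (o.volumeForm.compLinearMap e.symm.toLinearMap) β := by
  rw [← rayOfNeZero_volumeForm o, Orientation.map_apply, ray_eq_iff] at h
  exact h

instance instFiniteDimensionalTangent {n : ℕ} {M : Type*} [TopologicalSpace M]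
    [ChartedSpace (Model n) M] (x : M) : FiniteDimensional ℝ (TangentSpace (𝓡 n) x) :=
  inferInstanceAs (FiniteDimensional ℝ (Model n))

/-! ### Smoothness and nonvanishing of the volume form coefficient in charts. -/

section Riemannian

variable {n : ℕ} {M : Type*} [TopologicalSpace M] [ChartedSpace (Model n) M]
  [IsManifold (𝓡 n) ∞ M]

theorem contDiffAt_transition (p q : M) {y : Model n} (hy : y ∈ (extChartAt (𝓡 n) p).target)
    (hq : (extChartAt (𝓡 n) p).symm y ∈ (extChartAt (𝓡 n) q).source) :
    ContDiffAt ℝ ∞ (fun z => extChartAt (𝓡 n) q ((extChartAt (𝓡 n) p).symm z)) y :=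
  ((contMDiffAt_chart hq).comp y (contMDiffAt_chart_symm hy)).contDiffAt

variable [RiemannianBundle (fun x : M => TangentSpace (𝓡 n) x)]

/-- The coordinate frame of the chart at `p`. -/
def coordFrame (p : M) (i : Fin n) : (x : M) → TangentSpace (𝓡 n) x :=
  (trivializationAt (Model n) (TangentSpace (𝓡 n) : M → Type _) p).localFrame
    (EuclideanSpace.basisFun (Fin n) ℝ).toBasis i

omit [RiemannianBundle (fun x : M => TangentSpace (𝓡 n) x)] in
theorem coordFrame_eq_symm {p x : M}
    (hx : x ∈ (trivializationAt (Model n) (TangentSpace (𝓡 n) : M → Type _) p).baseSet)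
    (i : Fin n) :
    coordFrame p i x = ((trivializationAt (Model n) (TangentSpace (𝓡 n) : M → Type _)
      p).linearEquivAt ℝ x hx).symm (stdVec n i) := by
  rw [coordFrame, Bundle.Trivialization.localFrame_apply_of_mem_baseSet _ _ hx, stdVec_eq_basis]
  rfl

-- The frame of the bundle trivialisation is the frame of coordinate vectors. Smoothness of the
-- metric is available on the former, while `chartCoeff` is defined by the latter.
omit [RiemannianBundle (fun x : M => TangentSpace (𝓡 n) x)] in
theorem coordFrame_eq_mfderiv {p : M} {y : Model n} (hy : y ∈ (extChartAt (𝓡 n) p).target)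
    (i : Fin n) :
    coordFrame p i ((extChartAt (𝓡 n) p).symm y) =
      mfderiv (𝓡 n) (𝓡 n) (extChartAt (𝓡 n) p).symm y (stdVec n i) := by
  have hx : (extChartAt (𝓡 n) p).symm y ∈ (chartAt (Model n) p).source := by
    simpa using (extChartAt (𝓡 n) p).map_target hy
  have hb : (extChartAt (𝓡 n) p).symm y ∈
      (trivializationAt (Model n) (TangentSpace (𝓡 n) : M → Type _) p).baseSet := hx
  have h := TangentBundle.symmL_trivializationAt (I := 𝓡 n) hx
  rw [(extChartAt (𝓡 n) p).right_inv hy] at h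
  simp only [modelWithCornersSelf_coe, Set.range_id, mfderivWithin_univ] at h
  rw [coordFrame_eq_symm hb]
  exact (Bundle.Trivialization.symmL_apply (R := ℝ) _ hb (stdVec n i)).symm.trans
    (congrArg (fun L : Model n →L[ℝ] _ => L (stdVec n i)) h)

theorem chartCoeff_volForm_eq {o : ManifoldOrientation n M} {p : M} {y : Model n}
    (hy : y ∈ (extChartAt (𝓡 n) p).target) :
    chartCoeff (volForm o) p y = volForm o ((extChartAt (𝓡 n) p).symm y)
      (fun i : Fin n => coordFrame p i ((extChartAt (𝓡 n) p).symm y)) := by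
  simp only [coordFrame_eq_mfderiv hy]
  rfl

theorem volForm_coordFrame_ne_zero (o : ManifoldOrientation n M) {p x : M}
    (hx : x ∈ (trivializationAt (Model n) (TangentSpace (𝓡 n) : M → Type _) p).baseSet) :
    volForm o x (fun i : Fin n => coordFrame p i x) ≠ 0 := by
  have h := (AlternatingMap.map_basis_ne_zero_iff (Bundle.Trivialization.basisAt (𝕜 := ℝ)
    (trivializationAt (Model n) (TangentSpace (𝓡 n) : M → Type _) p)
    (EuclideanSpace.basisFun (Fin n) ℝ).toBasis hx) (volForm o x)).2
      (volumeForm_ne_zero (o.orient x))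
  convert! h using 3 with i
  rw [coordFrame, Bundle.Trivialization.localFrame_apply_of_mem_baseSet _ _ hx]

theorem chartCoeff_volForm_ne_zero (o : ManifoldOrientation n M) {p : M} {y : Model n}
    (hy : y ∈ (extChartAt (𝓡 n) p).target) : chartCoeff (volForm o) p y ≠ 0 := by
  rw [chartCoeff_volForm_eq hy]
  refine volForm_coordFrame_ne_zero o ?_
  have : (extChartAt (𝓡 n) p).symm y ∈ (chartAt (Model n) p).source := by
    simpa using (extChartAt (𝓡 n) p).map_target hy
  exact this

theorem volForm_sq_eq_det_gram (o : ManifoldOrientation n M) (x : M)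
    (v : Fin n → TangentSpace (𝓡 n) x) : volForm o x v ^ 2 = (Matrix.gram ℝ v).det :=
  volumeForm_sq_eq_det_gram (o.orient x) v

/-- The square of the left side is the Gram determinant, which fixes it up to sign. The sign is
constant near `p` because the orientation is locally constant in the trivialisation at `p`. -/
theorem volForm_coordFrame_eventually (o : ManifoldOrientation n M) (p : M) :
    ∃ c : ℝ, ∀ᶠ x in 𝓝 p, volForm o x (fun i : Fin n => coordFrame p i x) =
      c * √((Matrix.gram ℝ (fun i : Fin n => coordFrame p i x)).det) := by
  obtain ⟨o₀, ho⟩ := o.locallyConstant p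
  induction o₀ using Module.Ray.ind with
  | h β hβ =>
    -- β represents the constant orientation of the model space; near `p` the transported volume
    -- form is a positive multiple of it, so its sign on the standard basis is that of β.
    refine ⟨SignType.sign (β (stdVec n)), ?_⟩
    have hbs := (trivializationAt (Model n) (TangentSpace (𝓡 n) : M → Type _) p).open_baseSet.mem_nhds
      (FiberBundle.mem_baseSet_trivializationAt' p)
    filter_upwards [ho, hbs] with x hx hb
    have h1 := sameRay_volumeForm_of_map_eq _ _ β hβ (hx hb)
    have h2 : volForm o x (fun i : Fin n => coordFrame p i x) =
        ((o.orient x).volumeForm.compLinearMap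
        ((trivializationAt (Model n) (TangentSpace (𝓡 n) : M → Type _)
      p).linearEquivAt ℝ x hb).symm.toLinearMap) (stdVec n) := by
      simp only [coordFrame_eq_symm hb]
      rfl
    rw [← volForm_sq_eq_det_gram o, Real.sqrt_sq_eq_abs]
    have hβ' : β (stdVec n) ≠ 0 := by
      rw [stdVec_eq_basis]
      exact (AlternatingMap.map_basis_ne_zero_iff _ β).2 hβ
    have hne : (o.orient x).volumeForm.compLinearMap
        ((trivializationAt (Model n) (TangentSpace (𝓡 n) : M → Type _)
      p).linearEquivAt ℝ x hb).symm.toLinearMap ≠ 0 := by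
      intro h0
      exact volumeForm_ne_zero (o.orient x)
        ((AlternatingMap.compLinearEquiv_eq_zero_iff _ _).1 h0)
    obtain ⟨r, hr, hr'⟩ := h1.symm.exists_pos_left hβ hne
    rw [h2, ← hr', AlternatingMap.smul_apply, smul_eq_mul, abs_mul, abs_of_pos hr]
    rw [mul_left_comm, sign_mul_abs]

variable [IsContMDiffRiemannianBundle (𝓡 n) ∞ (Model n) (fun x : M => TangentSpace (𝓡 n) x)]

theorem contMDiffAt_det_gram_coordFrame (p : M) :
    ContMDiffAt (𝓡 n) 𝓘(ℝ, ℝ) ∞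
      (fun x => (Matrix.gram ℝ (fun i : Fin n => coordFrame p i x)).det) p := by
  simp only [Matrix.det_apply', Matrix.gram_apply]
  refine contMDiffAt_finsetSum fun σ _ => ?_
  refine ContMDiffAt.mul contMDiffAt_const (contMDiffAt_finsetProd fun i _ => ?_)
  exact ContMDiffAt.inner_bundle
    (contMDiffAt_localFrame_of_mem ∞ _ _ _ (FiberBundle.mem_baseSet_trivializationAt' p))
    (contMDiffAt_localFrame_of_mem ∞ _ _ _ (FiberBundle.mem_baseSet_trivializationAt' p))

theorem contMDiffAt_sqrt_det_gram_coordFrame (o : ManifoldOrientation n M) (p : M) :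
    ContMDiffAt (𝓡 n) 𝓘(ℝ, ℝ) ∞
      (fun x => √((Matrix.gram ℝ (fun i : Fin n => coordFrame p i x)).det)) p := by
  have h2 : (Matrix.gram ℝ (fun i : Fin n => coordFrame p i p)).det ≠ 0 := by
    rw [← volForm_sq_eq_det_gram o]
    exact pow_ne_zero _
      (volForm_coordFrame_ne_zero o (FiberBundle.mem_baseSet_trivializationAt' p))
  exact (Real.contDiffAt_sqrt h2).contMDiffAt.comp p (contMDiffAt_det_gram_coordFrame p)

/-- Only the centre of the chart is treated, since local constancy of the orientation is given near
`p` in the trivialisation at that same `p`. Other points are reached by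
`chartCoeff_volForm_contDiffAt`. -/
theorem chartCoeff_volForm_contDiffAt_center (o : ManifoldOrientation n M) (p : M) :
    ContDiffAt ℝ ∞ (chartCoeff (volForm o) p) (extChartAt (𝓡 n) p p) := by
  obtain ⟨c, hc⟩ := volForm_coordFrame_eventually o p
  have ht := extChartAt_target_mem_nhds (I := 𝓡 n) p
  have hs := contMDiffAt_chart_symm (mem_extChartAt_target (I := 𝓡 n) p)
  have h1 : ContMDiffAt (𝓡 n) 𝓘(ℝ, ℝ) ∞ (fun y : Model n => c *
      √((Matrix.gram ℝ (fun i : Fin n => coordFrame p i ((extChartAt (𝓡 n) p).symm y))).det))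
      (extChartAt (𝓡 n) p p) := by
    refine contMDiffAt_const.mul ?_
    refine ContMDiffAt.comp (I' := 𝓡 n) (g := fun x =>
      √((Matrix.gram ℝ (fun i : Fin n => coordFrame p i x)).det)) _ ?_ hs
    rw [extChartAt_to_inv]
    exact contMDiffAt_sqrt_det_gram_coordFrame o p
  refine h1.contDiffAt.congr_of_eventuallyEq ?_
  have hc' := hs.continuousAt.tendsto
  rw [extChartAt_to_inv] at hc'
  filter_upwards [ht, hc'.eventually hc] with y hy hy'
  rw [chartCoeff_volForm_eq hy, hy']

/-- In the chart centred at the point `q` over `y` the coefficient is already smooth; passing to the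
chart at `p` multiplies it by the smooth determinant of the transition map. -/
theorem chartCoeff_volForm_contDiffAt (o : ManifoldOrientation n M) {p : M} {y : Model n}
    (hy : y ∈ (extChartAt (𝓡 n) p).target) :
    ContDiffAt ℝ ∞ (chartCoeff (volForm o) p) y := by
  set q := (extChartAt (𝓡 n) p).symm y with hq
  have hT := contDiffAt_transition p q hy (mem_extChartAt_source q)
  have h1 : ContDiffAt ℝ ∞ (fun z =>
      (fderiv ℝ (fun z => extChartAt (𝓡 n) q ((extChartAt (𝓡 n) p).symm z)) z).det
        * chartCoeff (volForm o) q (extChartAt (𝓡 n) q ((extChartAt (𝓡 n) p).symm z))) y := by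
    refine ContDiffAt.mul ?_ ?_
    · exact contDiff_det.contDiffAt.comp y (hT.fderiv_right (by simp))
    · exact ContDiffAt.comp y (chartCoeff_volForm_contDiffAt_center o q) hT
  refine h1.congr_of_eventuallyEq ?_
  have hc := (contMDiffAt_chart_symm hy).continuousAt.preimage_mem_nhds
    ((isOpen_extChartAt_source (I := 𝓡 n) q).mem_nhds (mem_extChartAt_source q))
  filter_upwards [(isOpen_extChartAt_target (I := 𝓡 n) p).mem_nhds hy, hc] with z hz hz'
  exact paramCoeff_eq_det_mul _ (mdiffAt_chart_symm hz) hz'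

end Riemannian

/-! ### The variational equation in normed spaces. -/

section MixedDerivatives

variable {E F : Type*} [NormedAddCommGroup E] [NormedSpace ℝ E] [NormedAddCommGroup F]
  [NormedSpace ℝ F]

theorem fderiv_partial_snd {G : ℝ × E → F} {t : ℝ} {y : E} (hG : DifferentiableAt ℝ G (t, y)) :
    fderiv ℝ (fun z => G (t, z)) y = (fderiv ℝ G (t, y)).comp (ContinuousLinearMap.inr ℝ ℝ E) :=
  (hG.hasFDerivAt.comp y (hasFDerivAt_prodMk_right t y)).fderiv

theorem hasDerivAt_partial_fst {G : ℝ × E → F} {t : ℝ} {y : E}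
    (hG : DifferentiableAt ℝ G (t, y)) :
    HasDerivAt (fun s => G (s, y)) (fderiv ℝ G (t, y) (1, 0)) t :=
  hG.hasFDerivAt.comp_hasDerivAt t ((hasDerivAt_id t).prodMk (hasDerivAt_const t y))

/-- The variational equation: if `∂ₜ G = V ∘ G` at time `t`, then `∂ₜ D G = DV ∘ D G`. -/
theorem hasDerivAt_fderiv_of_flow {G : ℝ × E → F} {V : F → F} {t : ℝ} {y : E}
    (hG : ContDiffAt ℝ ∞ G (t, y)) (hV : DifferentiableAt ℝ V (G (t, y)))
    (h : ∀ᶠ z in 𝓝 y, HasDerivAt (fun s => G (s, z)) (V (G (t, z))) t) :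
    HasDerivAt (fun s => fderiv ℝ (fun z => G (s, z)) y)
      ((fderiv ℝ V (G (t, y))).comp (fderiv ℝ (fun z => G (t, z)) y)) t := by
  have hd : ∀ᶠ q in 𝓝 (t, y), DifferentiableAt ℝ G q := by
    have h1 : ContDiffAt ℝ 1 G (t, y) := hG.of_le (by simp)
    filter_upwards [h1.eventually (by exact_mod_cast ENat.one_ne_top)] with q hq
    exact hq.differentiableAt one_ne_zero
  have hd1 : ∀ᶠ s in 𝓝 t, DifferentiableAt ℝ G (s, y) :=
    (Continuous.prodMk_left y).continuousAt.eventually hd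
  have hd2 : ∀ᶠ z in 𝓝 y, DifferentiableAt ℝ G (t, z) :=
    (Continuous.prodMk_right t).continuousAt.eventually hd
  have hD : DifferentiableAt ℝ (fderiv ℝ G) (t, y) :=
    (hG.fderiv_right (m := ∞) (by simp)).differentiableAt (by simp)
  have h1 : HasDerivAt (fun s => (fderiv ℝ G (s, y)).comp (ContinuousLinearMap.inr ℝ ℝ E))
      ((fderiv ℝ (fderiv ℝ G) (t, y) (1, 0)).comp (ContinuousLinearMap.inr ℝ ℝ E)) t :=
    (((ContinuousLinearMap.compL ℝ E (ℝ × E) F).flip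
      (ContinuousLinearMap.inr ℝ ℝ E)).hasFDerivAt).comp_hasDerivAt t (hasDerivAt_partial_fst hD)
  have h2 : HasDerivAt (fun s => fderiv ℝ (fun z => G (s, z)) y)
      ((fderiv ℝ (fderiv ℝ G) (t, y) (1, 0)).comp (ContinuousLinearMap.inr ℝ ℝ E)) t := by
    refine h1.congr_of_eventuallyEq ?_
    filter_upwards [hd1] with s hs using fderiv_partial_snd hs
  convert h2 using 1
  have h3 : fderiv ℝ (fun z => V (G (t, z))) y =
      (fderiv ℝ V (G (t, y))).comp (fderiv ℝ (fun z => G (t, z)) y) := by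
    refine fderiv_comp y (g := V) hV ?_
    exact (hd2.self_of_nhds).comp y (hasFDerivAt_prodMk_right t y).differentiableAt
  -- The flow equation is known only at the single time t, but for all z near y, so it may be
  -- differentiated in z. This gives DV ∘ DG as a mixed derivative of G in the order opposite to the
  -- one wanted.
  have h4 : (fun z => V (G (t, z))) =ᶠ[𝓝 y] fun z => fderiv ℝ G (t, z) (1, 0) := by
    filter_upwards [h, hd2] with z hz hz' using hz.unique (hasDerivAt_partial_fst hz')
  have h5 : HasFDerivAt (fun z => fderiv ℝ G (t, z) (1, 0))
      ((ContinuousLinearMap.apply ℝ F ((1 : ℝ), (0 : E))).comp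
        ((fderiv ℝ (fderiv ℝ G) (t, y)).comp (ContinuousLinearMap.inr ℝ ℝ E))) y :=
    (ContinuousLinearMap.apply ℝ F ((1 : ℝ), (0 : E))).hasFDerivAt.comp y
      (hD.hasFDerivAt.comp y (hasFDerivAt_prodMk_right t y))
  rw [← h3, h4.fderiv_eq, h5.fderiv]
  ext w
  -- Symmetry of the second derivative exchanges the time and space directions.
  have hs := (hG.isSymmSndFDerivAt (by simp; exact WithTop.coe_le_coe.2 le_top)).eq (0, w) (1, 0)
  simpa using hs

end MixedDerivatives

/-! ### The Jacobian in charts: smoothness and time derivative. -/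

section Jacobian

variable {n : ℕ} {M : Type*} [TopologicalSpace M] [ChartedSpace (Model n) M]
  [IsManifold (𝓡 n) ∞ M]

/-- A time dependent map in the charts at `p` and `q`. -/
def chartMap (p q : M) (F : ℝ → M → M) (r : ℝ × Model n) : Model n :=
  extChartAt (𝓡 n) q (F r.1 ((extChartAt (𝓡 n) p).symm r.2))

theorem contDiffAt_chartMap {F : ℝ → M → M} {t : ℝ} {p q : M} {y : Model n}
    (hy : y ∈ (extChartAt (𝓡 n) p).target)
    (hF : ContMDiffAt (𝓘(ℝ, ℝ).prod (𝓡 n)) (𝓡 n) ∞ (fun r : ℝ × M => F r.1 r.2)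
      (t, (extChartAt (𝓡 n) p).symm y))
    (hq : F t ((extChartAt (𝓡 n) p).symm y) ∈ (extChartAt (𝓡 n) q).source) :
    ContDiffAt ℝ ∞ (chartMap p q F) (t, y) := by
  have h1 : ContMDiffAt (𝓘(ℝ, ℝ).prod (𝓡 n)) (𝓘(ℝ, ℝ).prod (𝓡 n)) ∞
      (fun r : ℝ × Model n => (r.1, (extChartAt (𝓡 n) p).symm r.2)) (t, y) :=
    contMDiffAt_fst.prodMk (ContMDiffAt.comp (t, y) (contMDiffAt_chart_symm hy) contMDiffAt_snd)
  have h2 : ContMDiffAt (𝓘(ℝ, ℝ).prod (𝓡 n)) (𝓡 n) ∞ (chartMap p q F) (t, y) :=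
    ContMDiffAt.comp (t, y) (contMDiffAt_chart hq) (ContMDiffAt.comp (t, y) hF h1)
  rw [← modelWithCornersSelf_prod, chartedSpaceSelf_prod] at h2
  exact h2.contDiffAt

theorem eventually_mdifferentiableAt_slice {F : ℝ → M → M} {t : ℝ} {x : M}
    (hF : ContMDiffAt (𝓘(ℝ, ℝ).prod (𝓡 n)) (𝓡 n) ∞ (fun r : ℝ × M => F r.1 r.2) (t, x)) :
    ∀ᶠ r in 𝓝 (t, x), MDifferentiableAt (𝓡 n) (𝓡 n) (F r.1) r.2 := by
  have h1 : ContMDiffAt (𝓘(ℝ, ℝ).prod (𝓡 n)) (𝓡 n) 1 (fun r : ℝ × M => F r.1 r.2) (t, x) :=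
    hF.of_le (by simp)
  have h2 := (contMDiffAt_iff_contMDiffAt_nhds (by exact_mod_cast ENat.one_ne_top)).1 h1
  filter_upwards [h2] with r hr
  have h3 : MDifferentiableAt (𝓘(ℝ, ℝ).prod (𝓡 n)) (𝓡 n) (fun r : ℝ × M => F r.1 r.2)
    (r.1, r.2) := hr.mdifferentiableAt (by simp)
  exact MDifferentiableAt.comp (f := fun z => (r.1, z)) r.2 h3
    (mdifferentiableAt_const.prodMk mdifferentiableAt_id)

theorem chartComp_chart (v : VField n M) {q x : M} (hx : x ∈ (extChartAt (𝓡 n) q).source) :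
    chartComp v q (extChartAt (𝓡 n) q x) =
      mfderiv (𝓡 n) (𝓡 n) (extChartAt (𝓡 n) q) x (v x) := by
  have h := chartComp_apply v ((extChartAt (𝓡 n) q).map_source hx)
  rw [(extChartAt (𝓡 n) q).left_inv hx] at h
  exact h

theorem hasDerivAt_chart_comp {γ : ℝ → M} {t : ℝ} {q : M} (v : VField n M)
    (hγ : HasMFDerivAt 𝓘(ℝ, ℝ) (𝓡 n) γ t ((1 : ℝ →L[ℝ] ℝ).smulRight (v (γ t))))
    (hq : γ t ∈ (extChartAt (𝓡 n) q).source) :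
    HasDerivAt (fun s => extChartAt (𝓡 n) q (γ s))
      (chartComp v q (extChartAt (𝓡 n) q (γ t))) t := by
  have h := ((mdiffAt_chart hq).hasMFDerivAt.comp t hγ).hasFDerivAt
  have h' : HasFDerivAt (fun s => extChartAt (𝓡 n) q (γ s))
      ((1 : ℝ →L[ℝ] ℝ).smulRight (chartComp v q (extChartAt (𝓡 n) q (γ t)))) t := by
    refine HasFDerivAt.congr_fderiv h (ContinuousLinearMap.ext_ring ?_)
    rw [chartComp_chart v hq]
    exact (map_smul (mfderiv (𝓡 n) (𝓡 n) (extChartAt (𝓡 n) q) (γ t)) (1 : ℝ) (v (γ t)))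
  simpa using h'.hasDerivAt

/-- The formula for the divergence in the chart at `q`. -/
def chartDiv (μ : TopForm n M) (v : VField n M) (q : M) (y : Model n) : ℝ :=
  LinearMap.trace ℝ (Model n) (fderiv ℝ (chartComp v q) y).toLinearMap
    + fderiv ℝ (chartCoeff μ q) y (chartComp v q y) / chartCoeff μ q y

variable [RiemannianBundle (fun x : M => TangentSpace (𝓡 n) x)]

/-- The coefficient of f^*μ in the chart at `p` is computed twice: as J times that of μ, and by the
transformation rule through the chart at `q`. -/
theorem jac_eq_det_mul (o : ManifoldOrientation n M) {f : M → M} {p q x : M}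
    (hp : x ∈ (extChartAt (𝓡 n) p).source) (hf : MDifferentiableAt (𝓡 n) (𝓡 n) f x)
    (hq : f x ∈ (extChartAt (𝓡 n) q).source) :
    jac o f x = (fderiv ℝ (fun z => extChartAt (𝓡 n) q (f ((extChartAt (𝓡 n) p).symm z)))
        (extChartAt (𝓡 n) p x)).det * chartCoeff (volForm o) q (extChartAt (𝓡 n) q (f x))
        / chartCoeff (volForm o) p (extChartAt (𝓡 n) p x) := by
  have hy := (extChartAt (𝓡 n) p).map_source hp
  have hl := (extChartAt (𝓡 n) p).left_inv hp
  have h1 : chartCoeff (pullback f (volForm o)) p (extChartAt (𝓡 n) p x) =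
      jac o f x * chartCoeff (volForm o) p (extChartAt (𝓡 n) p x) := by
    have h2 : chartCoeff (volForm o) p (extChartAt (𝓡 n) p x) = volForm o x (fun i =>
      mfderiv (𝓡 n) (𝓡 n) (extChartAt (𝓡 n) p).symm (extChartAt (𝓡 n) p x) (stdVec n i)) := by
      rw [chartCoeff, hl]
    rw [h2, chartCoeff, pullback_volForm, hl, AlternatingMap.smul_apply, smul_eq_mul]
  have hf' : MDifferentiableAt (𝓡 n) (𝓡 n) f
      ((extChartAt (𝓡 n) p).symm (extChartAt (𝓡 n) p x)) := by rwa [hl]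
  rw [eq_div_iff (chartCoeff_volForm_ne_zero o hy), ← h1, chartCoeff_pullback _ _ hy hf']
  rw [paramCoeff_eq_det_mul (q := q)
    (ψ := fun z => f ((extChartAt (𝓡 n) p).symm z)) _ (hf'.comp (I' := 𝓡 n) _ (mdiffAt_chart_symm hy))
    (by simpa only [hl] using hq)]
  simp only [hl]

variable [IsContMDiffRiemannianBundle (𝓡 n) ∞ (Model n) (fun x : M => TangentSpace (𝓡 n) x)]

/-- The Jacobian of a smooth family of maps is smooth. -/
theorem contMDiffAt_jac (o : ManifoldOrientation n M) {F : ℝ → M → M} {t : ℝ} {x : M}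
    (hF : ContMDiffAt (𝓘(ℝ, ℝ).prod (𝓡 n)) (𝓡 n) ∞ (fun r : ℝ × M => F r.1 r.2) (t, x)) :
    ContMDiffAt (𝓘(ℝ, ℝ).prod (𝓡 n)) 𝓘(ℝ, ℝ) ∞ (fun r : ℝ × M => jac o (F r.1) r.2) (t, x) := by
  set q := F t x with hq
  have hx := mem_extChartAt_source (I := 𝓡 n) x
  have hxt := mem_extChartAt_target (I := 𝓡 n) x
  have hl := extChartAt_to_inv (I := 𝓡 n) x
  have hG : ContDiffAt ℝ ∞ (chartMap x q F) (t, extChartAt (𝓡 n) x x) := by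
    refine contDiffAt_chartMap hxt ?_ ?_
    · rwa [hl]
    · rw [hl]
      exact mem_extChartAt_source q
  have hGv : chartMap x q F (t, extChartAt (𝓡 n) x x) = extChartAt (𝓡 n) q q := by
    rw [chartMap, hl]
  have h1 : ContDiffAt ℝ ∞ (fun r : ℝ × Model n =>
      (fderiv ℝ (fun z => chartMap x q F (r.1, z)) r.2).det *
        chartCoeff (volForm o) q (chartMap x q F r) / chartCoeff (volForm o) x r.2)
      (t, extChartAt (𝓡 n) x x) := by
    refine ContDiffAt.div (ContDiffAt.mul ?_ ?_) ?_ (chartCoeff_volForm_ne_zero o hxt)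
    · refine contDiff_det.contDiffAt.comp (t, extChartAt (𝓡 n) x x) ?_
      -- The determinant involves only the space derivative, so the base point (t, y) is treated as
      -- a parameter separate from the variable of differentiation.
      have hA : ContDiffAt ℝ ∞
          (Function.uncurry fun (r : ℝ × Model n) z => chartMap x q F (r.1, z))
          ((t, extChartAt (𝓡 n) x x), extChartAt (𝓡 n) x x) :=
        ContDiffAt.comp (g := chartMap x q F)
          (f := fun w : (ℝ × Model n) × Model n => (w.1.1, w.2)) _ hG (by fun_prop)
      exact ContDiffAt.fderiv (n := ∞)
        (f := fun (r : ℝ × Model n) z => chartMap x q F (r.1, z)) (g := Prod.snd) hA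
        contDiffAt_snd (by simp)
    · refine ContDiffAt.comp (g := chartCoeff (volForm o) q) (t, extChartAt (𝓡 n) x x) ?_ hG
      rw [hGv]
      exact chartCoeff_volForm_contDiffAt o (mem_extChartAt_target q)
    · exact ContDiffAt.comp (g := chartCoeff (volForm o) x) (t, extChartAt (𝓡 n) x x) (chartCoeff_volForm_contDiffAt o hxt)
        contDiffAt_snd
  have h2 : ContMDiffAt (𝓘(ℝ, ℝ).prod (𝓡 n)) (𝓘(ℝ, ℝ).prod (𝓡 n)) ∞
      (fun r : ℝ × M => (r.1, extChartAt (𝓡 n) x r.2)) (t, x) :=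
    contMDiffAt_fst.prodMk (ContMDiffAt.comp (t, x) (contMDiffAt_chart hx) contMDiffAt_snd)
  have h1' := h1.contMDiffAt
  rw [modelWithCornersSelf_prod, ← chartedSpaceSelf_prod] at h1'
  refine (ContMDiffAt.comp (t, x) h1' h2).congr_of_eventuallyEq ?_
  have e1 : ∀ᶠ r : ℝ × M in 𝓝 (t, x), F r.1 r.2 ∈ (extChartAt (𝓡 n) q).source :=
    hF.continuousAt.preimage_mem_nhds (extChartAt_source_mem_nhds (I := 𝓡 n) q)
  have e2 : ∀ᶠ r : ℝ × M in 𝓝 (t, x), r.2 ∈ (extChartAt (𝓡 n) x).source :=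
    continuousAt_snd.preimage_mem_nhds (extChartAt_source_mem_nhds (I := 𝓡 n) x)
  filter_upwards [e1, e2, eventually_mdifferentiableAt_slice hF] with r hr1 hr2 hr3
  simp only [Function.comp_apply, chartMap, (extChartAt (𝓡 n) x).left_inv hr2]
  exact jac_eq_det_mul o hr2 hr3 hr1

/-- The derivative of the Jacobian along a family of maps with velocity `v`, where the divergence
is computed in any chart. -/
theorem hasDerivAt_jac_chartDiv (o : ManifoldOrientation n M) {F : ℝ → M → M} {t : ℝ} {x : M}
    (v : VField n M)
    (hF : ContMDiffAt (𝓘(ℝ, ℝ).prod (𝓡 n)) (𝓡 n) ∞ (fun r : ℝ × M => F r.1 r.2) (t, x))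
    (hv : ∀ᶠ z in 𝓝 x, HasMFDerivAt 𝓘(ℝ, ℝ) (𝓡 n) (fun s => F s z) t
      ((1 : ℝ →L[ℝ] ℝ).smulRight (v (F t z))))
    {q : M} (hq : F t x ∈ (extChartAt (𝓡 n) q).source) :
    HasDerivAt (fun s => jac o (F s) x)
      (chartDiv (volForm o) v q (extChartAt (𝓡 n) q (F t x)) * jac o (F t) x) t := by
  have hx := mem_extChartAt_source (I := 𝓡 n) x
  have hxt := mem_extChartAt_target (I := 𝓡 n) x
  have hl := extChartAt_to_inv (I := 𝓡 n) x
  have hqt := (extChartAt (𝓡 n) q).map_source hq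
  have hG : ContDiffAt ℝ ∞ (chartMap x q F) (t, extChartAt (𝓡 n) x x) := by
    refine contDiffAt_chartMap hxt ?_ ?_
    · rwa [hl]
    · rwa [hl]
  have hGv : ∀ s, chartMap x q F (s, extChartAt (𝓡 n) x x) = extChartAt (𝓡 n) q (F s x) := by
    intro s
    rw [chartMap, hl]
  have hsrc : ∀ᶠ r : ℝ × M in 𝓝 (t, x), F r.1 r.2 ∈ (extChartAt (𝓡 n) q).source :=
    hF.continuousAt.preimage_mem_nhds ((isOpen_extChartAt_source (I := 𝓡 n) q).mem_nhds hq)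
  have hsrc1 : ∀ᶠ z in 𝓝 x, F t z ∈ (extChartAt (𝓡 n) q).source :=
    (Continuous.prodMk_right t).continuousAt.eventually hsrc
  have hev : ∀ᶠ z in 𝓝 (extChartAt (𝓡 n) x x), HasDerivAt (fun s => chartMap x q F (s, z))
      (chartComp v q (chartMap x q F (t, z))) t := by
    have hc := (contMDiffAt_chart_symm hxt).continuousAt.tendsto
    rw [hl] at hc
    filter_upwards [hc.eventually hv, hc.eventually hsrc1] with z hz hz'
    exact hasDerivAt_chart_comp v hz hz'
  have hflow := hasDerivAt_fderiv_of_flow hG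
    (by rw [hGv]; exact (chartComp_contDiffAt v hqt).differentiableAt (by simp)) hev
  have hdet := hasDerivAt_det hflow
  have hρ : HasDerivAt (fun s => chartCoeff (volForm o) q (extChartAt (𝓡 n) q (F s x)))
      (fderiv ℝ (chartCoeff (volForm o) q) (extChartAt (𝓡 n) q (F t x))
        (chartComp v q (extChartAt (𝓡 n) q (F t x)))) t := by
    have h1 := hev.self_of_nhds
    simp only [hGv] at h1
    exact (((chartCoeff_volForm_contDiffAt o hqt).differentiableAt
      (by simp)).hasFDerivAt).comp_hasDerivAt t h1
  have hprod := (hdet.mul hρ).div_const (chartCoeff (volForm o) x (extChartAt (𝓡 n) x x))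
  have hmd : ∀ᶠ s in 𝓝 t, MDifferentiableAt (𝓡 n) (𝓡 n) (F s) x :=
    (Continuous.prodMk_left x).continuousAt.eventually (eventually_mdifferentiableAt_slice hF)
  have hsrc2 : ∀ᶠ s in 𝓝 t, F s x ∈ (extChartAt (𝓡 n) q).source :=
    (Continuous.prodMk_left x).continuousAt.eventually hsrc
  have hjac : (fun s => jac o (F s) x) =ᶠ[𝓝 t] fun s =>
      (fderiv ℝ (fun z => chartMap x q F (s, z)) (extChartAt (𝓡 n) x x)).det *
      chartCoeff (volForm o) q (extChartAt (𝓡 n) q (F s x)) /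
      chartCoeff (volForm o) x (extChartAt (𝓡 n) x x) := by
    filter_upwards [hmd, hsrc2] with s hs hs'
    exact jac_eq_det_mul o hx hs hs'
  -- The product rule gives (tr DV · det · ρ + det · dρ(V)) / ρ₀, where ρ₀ is the coefficient at x
  -- and does not depend on time. Since ρ ≠ 0, the factor J = det · ρ / ρ₀ splits off and leaves
  -- `chartDiv`.
  convert! hprod.congr_of_eventuallyEq hjac using 1
  have hjt : jac o (F t) x = _ := hjac.self_of_nhds
  rw [hjt, chartDiv, hGv]
  have h0 := chartCoeff_volForm_ne_zero o hqt
  field_simp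

end Jacobian

/-! ### Chart independence and continuity of the divergence. -/

section Divergence

variable {n : ℕ} {M : Type*} [TopologicalSpace M] [ChartedSpace (Model n) M]
  [IsManifold (𝓡 n) ∞ M]

/-- The family of maps which moves points along the straight lines of the chart at `p` in the
direction of `v`. -/
def chartShift (v : VField n M) (p : M) (s : ℝ) (x : M) : M :=
  (extChartAt (𝓡 n) p).symm
    (extChartAt (𝓡 n) p x + s • chartComp v p (extChartAt (𝓡 n) p x))

theorem chartShift_zero (v : VField n M) {p x : M} (hx : x ∈ (extChartAt (𝓡 n) p).source) :
    chartShift v p 0 x = x := by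
  rw [chartShift, zero_smul, add_zero, (extChartAt (𝓡 n) p).left_inv hx]

theorem contMDiffAt_chartShift (v : VField n M) {p x : M}
    (hx : x ∈ (extChartAt (𝓡 n) p).source) :
    ContMDiffAt (𝓘(ℝ, ℝ).prod (𝓡 n)) (𝓡 n) ∞ (fun r : ℝ × M => chartShift v p r.1 r.2)
      (0, x) := by
  have hy := (extChartAt (𝓡 n) p).map_source hx
  have h1 : ContMDiffAt (𝓘(ℝ, ℝ).prod (𝓡 n)) (𝓡 n) ∞
      (fun r : ℝ × M => extChartAt (𝓡 n) p r.2) (0, x) :=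
    ContMDiffAt.comp (0, x) (contMDiffAt_chart hx) contMDiffAt_snd
  have h2 : ContMDiffAt (𝓘(ℝ, ℝ).prod (𝓡 n)) (𝓡 n) ∞
      (fun r : ℝ × M => chartComp v p (extChartAt (𝓡 n) p r.2)) (0, x) :=
    ContMDiffAt.comp (g := chartComp v p) (I' := 𝓡 n) (0, x)
      (chartComp_contDiffAt v hy).contMDiffAt h1
  refine ContMDiffAt.comp (g := (extChartAt (𝓡 n) p).symm) (I' := 𝓡 n) (0, x) ?_
    (h1.add (contMDiffAt_fst.smul h2))
  simp only [zero_smul, add_zero]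
  exact contMDiffAt_chart_symm hy

theorem hasMFDerivAt_chartShift (v : VField n M) {p x : M}
    (hx : x ∈ (extChartAt (𝓡 n) p).source) :
    HasMFDerivAt 𝓘(ℝ, ℝ) (𝓡 n) (fun s => chartShift v p s x) 0
      ((1 : ℝ →L[ℝ] ℝ).smulRight (v (chartShift v p 0 x))) := by
  have hy := (extChartAt (𝓡 n) p).map_source hx
  have h1 : HasFDerivAt
      (fun s : ℝ => extChartAt (𝓡 n) p x + s • chartComp v p (extChartAt (𝓡 n) p x))
      ((1 : ℝ →L[ℝ] ℝ).smulRight (chartComp v p (extChartAt (𝓡 n) p x))) 0 :=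
    (((1 : ℝ →L[ℝ] ℝ).smulRight (chartComp v p (extChartAt (𝓡 n) p x))).hasFDerivAt).const_add _
  have h0 : extChartAt (𝓡 n) p x + (0 : ℝ) • chartComp v p (extChartAt (𝓡 n) p x) =
      extChartAt (𝓡 n) p x := by simp
  have hs : ∀ z, z = extChartAt (𝓡 n) p x → HasMFDerivAt (𝓡 n) (𝓡 n) (extChartAt (𝓡 n) p).symm z
      (mfderiv (𝓡 n) (𝓡 n) (extChartAt (𝓡 n) p).symm (extChartAt (𝓡 n) p x)) := by
    rintro z rfl
    exact (mdiffAt_chart_symm hy).hasMFDerivAt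
  have h2 := (hs _ h0).comp (0 : ℝ) h1.hasMFDerivAt
  rw [chartShift_zero v hx]
  refine HasMFDerivAt.congr_mfderiv h2 (ContinuousLinearMap.ext_ring ?_)
  rw [chartComp_chart v hx]
  have h3 := mfderiv_chart_comp_symm hy
  rw [(extChartAt (𝓡 n) p).left_inv hx] at h3
  have h4 := congrArg (fun L : TangentSpace (𝓡 n) x →L[ℝ] TangentSpace (𝓡 n) x => L (v x)) h3
  change mfderiv (𝓡 n) (𝓡 n) (extChartAt (𝓡 n) p).symm (extChartAt (𝓡 n) p x)
    ((1 : ℝ) • mfderiv (𝓡 n) (𝓡 n) (extChartAt (𝓡 n) p) x (v x)) = (1 : ℝ) • v x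
  rw [one_smul, one_smul]
  exact h4

variable [RiemannianBundle (fun x : M => TangentSpace (𝓡 n) x)]

/-- Equality with the identity is required only near `x` because `chartShift` at time 0 is known to
be the identity only on the source of its chart. -/
theorem jac_eq_one_of_eventuallyEq_id (o : ManifoldOrientation n M) {f : M → M} {x : M}
    (h : ∀ᶠ z in 𝓝 x, f z = z) : jac o f x = 1 := by
  have hx := mem_extChartAt_source (I := 𝓡 n) x
  have hfx : f x = x := h.self_of_nhds
  have hf : MDifferentiableAt (𝓡 n) (𝓡 n) f x :=
    (mdifferentiableAt_id (x := x)).congr_of_eventuallyEq h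
  have hxt := mem_extChartAt_target (I := 𝓡 n) x
  have hc := (contMDiffAt_chart_symm hxt).continuousAt.tendsto
  rw [extChartAt_to_inv] at hc
  have he : (fun z => extChartAt (𝓡 n) x (f ((extChartAt (𝓡 n) x).symm z)))
      =ᶠ[𝓝 (extChartAt (𝓡 n) x x)] id := by
    filter_upwards [hc.eventually h, extChartAt_target_mem_nhds (I := 𝓡 n) x] with z hz hz'
    rw [hz, (extChartAt (𝓡 n) x).right_inv hz', id]
  rw [jac_eq_det_mul o hx hf (by rwa [hfx]), he.fderiv_eq, fderiv_id, hfx]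
  have : (ContinuousLinearMap.id ℝ (Model n)).det = 1 := LinearMap.det_id
  rw [this, one_mul, div_self (chartCoeff_volForm_ne_zero o hxt)]

variable [IsContMDiffRiemannianBundle (𝓡 n) ∞ (Model n) (fun x : M => TangentSpace (𝓡 n) x)]

/-- The divergence can be computed in any chart. -/
theorem divergence_eq_chartDiv (o : ManifoldOrientation n M) (v : VField n M) {q x : M}
    (hq : x ∈ (extChartAt (𝓡 n) q).source) :
    divergence (volForm o) v x = chartDiv (volForm o) v q (extChartAt (𝓡 n) q x) := by
  have hx := mem_extChartAt_source (I := 𝓡 n) x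
  have hsrc := extChartAt_source_mem_nhds (I := 𝓡 n) x
  -- The shift is a local family with initial velocity `v` and J = 1 at time 0. The derivative of
  -- its Jacobian, computed in the charts at `x` and at `q`, is the divergence formula of each
  -- chart, and derivatives are unique. No flow of `v` is needed.
  have hF := contMDiffAt_chartShift v hx
  have hv : ∀ᶠ z in 𝓝 x, HasMFDerivAt 𝓘(ℝ, ℝ) (𝓡 n) (fun s => chartShift v x s z) 0
      ((1 : ℝ →L[ℝ] ℝ).smulRight (v (chartShift v x 0 z))) := by
    filter_upwards [hsrc] with z hz using hasMFDerivAt_chartShift v hz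
  have h0 := chartShift_zero v hx
  have h1 := hasDerivAt_jac_chartDiv o v hF hv (q := x) (by rwa [h0])
  have h2 := hasDerivAt_jac_chartDiv o v hF hv (q := q) (by rwa [h0])
  have h3 : jac o (chartShift v x 0) x = 1 := by
    refine jac_eq_one_of_eventuallyEq_id o ?_
    filter_upwards [hsrc] with z hz using chartShift_zero v hz
  have h4 := h1.unique h2
  rwa [h3, mul_one, mul_one, h0] at h4

theorem hasDerivAt_jac (o : ManifoldOrientation n M) {F : ℝ → M → M} {t : ℝ} {x : M}
    (v : VField n M)
    (hF : ContMDiffAt (𝓘(ℝ, ℝ).prod (𝓡 n)) (𝓡 n) ∞ (fun r : ℝ × M => F r.1 r.2) (t, x))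
    (hv : ∀ᶠ z in 𝓝 x, HasMFDerivAt 𝓘(ℝ, ℝ) (𝓡 n) (fun s => F s z) t
      ((1 : ℝ →L[ℝ] ℝ).smulRight (v (F t z)))) :
    HasDerivAt (fun s => jac o (F s) x)
      (divergence (volForm o) v (F t x) * jac o (F t) x) t :=
  hasDerivAt_jac_chartDiv o v hF hv (mem_extChartAt_source (F t x))

theorem continuousAt_chartDiv (o : ManifoldOrientation n M) (v : VField n M) {q : M} {y : Model n}
    (hy : y ∈ (extChartAt (𝓡 n) q).target) :
    ContinuousAt (chartDiv (volForm o) v q) y := by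
  have hV := chartComp_contDiffAt v hy
  have hρ := chartCoeff_volForm_contDiffAt o hy
  have h1 : ContinuousAt (fderiv ℝ (chartComp v q)) y :=
    (hV.fderiv_right (m := ∞) (by simp)).continuousAt
  have h2 : ContinuousAt (fderiv ℝ (chartCoeff (volForm o) q)) y :=
    (hρ.fderiv_right (m := ∞) (by simp)).continuousAt
  have h3 : Continuous (fun L : Model n →L[ℝ] Model n =>
      LinearMap.trace ℝ (Model n) L.toLinearMap) :=
    ((LinearMap.trace ℝ (Model n)) ∘ₗ
      (ContinuousLinearMap.coeLM ℝ : (Model n →L[ℝ] Model n) →ₗ[ℝ] _)).continuous_of_finiteDimensional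
  exact (h3.continuousAt.comp h1).add
    ((h2.clm_apply hV.continuousAt).div hρ.continuousAt (chartCoeff_volForm_ne_zero o hy))

/-- The definition uses a different chart at every point; chart independence replaces them near `x`
by the single chart at `x`. -/
theorem continuous_divergence (o : ManifoldOrientation n M) (v : VField n M) :
    Continuous (divergence (volForm o) v) := by
  rw [continuous_iff_continuousAt]
  intro x
  have h := (continuousAt_chartDiv o v (mem_extChartAt_target (I := 𝓡 n) x)).comp
    (continuousAt_extChartAt (I := 𝓡 n) x)
  refine h.congr ?_
  filter_upwards [extChartAt_source_mem_nhds (I := 𝓡 n) x] with z hz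
  exact (divergence_eq_chartDiv o v hz).symm

end Divergence

/-! ### Positivity and cocycle property of the Jacobian; cosets. -/

section Orientation

variable {n : ℕ} {M : Type*} [TopologicalSpace M] [ChartedSpace (Model n) M]
  [IsManifold (𝓡 n) ∞ M] [RiemannianBundle (fun x : M => TangentSpace (𝓡 n) x)]

/-- Preserving orientation puts ξ^*μ and μ on the same ray, so J ≥ 0; since dξ is invertible, ξ^*μ
does not vanish and J ≠ 0. -/
theorem jac_pos (o : ManifoldOrientation n M) (ξ : Diff o) (x : M) :
    0 < jac o (ξ : M ≃ₘ^∞⟮𝓡 n, 𝓡 n⟯ M) x := by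
  have h1 := ξ.2 x
  rw [← rayOfNeZero_volumeForm (o.orient ((ξ : M ≃ₘ^∞⟮𝓡 n, 𝓡 n⟯ M) x))] at h1
  have h2 := sameRay_volumeForm_of_map_eq _ _ _ _ h1
  -- The ray relation lives on the tangent space at ξ x; pulling it back by dξ moves it to the
  -- tangent space at x.
  have h3 := h2.map ((AlternatingMap.domLCongr ℝ ℝ (Fin n) ℝ
    (tangentEquiv (ξ : M ≃ₘ^∞⟮𝓡 n, 𝓡 n⟯ M) x)).symm.toLinearMap)
  have h4 : SameRay ℝ (volForm o x) (pullback (ξ : M ≃ₘ^∞⟮𝓡 n, 𝓡 n⟯ M) (volForm o) x) := by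
    convert! h3 using 1
    ext w
    change volForm o x w = volForm o x (fun i => (tangentEquiv (ξ : M ≃ₘ^∞⟮𝓡 n, 𝓡 n⟯ M) x).symm
      (tangentEquiv (ξ : M ≃ₘ^∞⟮𝓡 n, 𝓡 n⟯ M) x (w i)))
    simp
  have hne : volForm o x ≠ 0 := volumeForm_ne_zero (o.orient x)
  rw [pullback_volForm, sameRay_smul_right_iff] at h4
  refine lt_of_le_of_ne (h4.resolve_right hne) (fun h => ?_)
  have h5 := pullback_volForm o (ξ : M ≃ₘ^∞⟮𝓡 n, 𝓡 n⟯ M) x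
  rw [← h, zero_smul] at h5
  have h6 : (volForm o ((ξ : M ≃ₘ^∞⟮𝓡 n, 𝓡 n⟯ M) x)).compLinearMap
    (tangentEquiv (ξ : M ≃ₘ^∞⟮𝓡 n, 𝓡 n⟯ M) x).toLinearMap = 0 := h5
  exact volumeForm_ne_zero _ ((AlternatingMap.compLinearEquiv_eq_zero_iff _ _).1 h6)

theorem jac_mul (o : ManifoldOrientation n M) (η ξ : Diff o) (x : M) :
    jac o ((η * ξ : Diff o) : M ≃ₘ^∞⟮𝓡 n, 𝓡 n⟯ M) x =
      jac o (η : M ≃ₘ^∞⟮𝓡 n, 𝓡 n⟯ M) ((ξ : M ≃ₘ^∞⟮𝓡 n, 𝓡 n⟯ M) x) *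
        jac o (ξ : M ≃ₘ^∞⟮𝓡 n, 𝓡 n⟯ M) x := by
  have hne : volForm o x ≠ 0 := volumeForm_ne_zero (o.orient x)
  refine smul_left_injective ℝ hne ?_
  simp only
  rw [← pullback_volForm, mul_smul, ← pullback_volForm]
  ext w
  rw [Subgroup.coe_mul, pullback_mul]
  simp only [pullback, AlternatingMap.compLinearMap_apply, AlternatingMap.smul_apply]
  have h := congrArg (fun β => β (fun i => mfderiv (𝓡 n) (𝓡 n) (ξ : M ≃ₘ^∞⟮𝓡 n, 𝓡 n⟯ M) x (w i)))
    (pullback_volForm o (η : M ≃ₘ^∞⟮𝓡 n, 𝓡 n⟯ M) ((ξ : M ≃ₘ^∞⟮𝓡 n, 𝓡 n⟯ M) x))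
  exact h

theorem jac_eq_one_iff (o : ManifoldOrientation n M) (η : Diff o) :
    η ∈ VolDiff o ↔ ∀ x, jac o (η : M ≃ₘ^∞⟮𝓡 n, 𝓡 n⟯ M) x = 1 := by
  change pullback (η : M ≃ₘ^∞⟮𝓡 n, 𝓡 n⟯ M) (volForm o) = volForm o ↔ _
  constructor
  · intro h x
    have hne : volForm o x ≠ 0 := volumeForm_ne_zero (o.orient x)
    refine smul_left_injective ℝ hne ?_
    simp only
    rw [← pullback_volForm, h, one_smul]
  · intro h
    funext x
    rw [pullback_volForm, h x, one_smul]

/-- If the Jacobians agree, the cocycle identity for ζ = (ζ ξ⁻¹) ξ shows that ζ ξ⁻¹ has Jacobian 1,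
after cancelling the positive Jac ξ. This gives both that Ψ is well defined and that it is
injective. -/
theorem proj_eq_iff_jac_eq (o : ManifoldOrientation n M) (ξ ζ : Diff o) :
    Dens.proj o ξ = Dens.proj o ζ ↔ ∀ x, jac o (ξ : M ≃ₘ^∞⟮𝓡 n, 𝓡 n⟯ M) x =
      jac o (ζ : M ≃ₘ^∞⟮𝓡 n, 𝓡 n⟯ M) x := by
  rw [Dens.proj_eq_iff]
  constructor
  · rintro ⟨η, hη, rfl⟩ x
    rw [jac_mul, (jac_eq_one_iff o η).1 hη, one_mul]
  · intro h
    refine ⟨ζ * ξ⁻¹, ?_, by group⟩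
    rw [jac_eq_one_iff]
    intro x
    obtain ⟨y, rfl⟩ := (ξ : M ≃ₘ^∞⟮𝓡 n, 𝓡 n⟯ M).surjective x
    have h1 := jac_mul o (ζ * ξ⁻¹) ξ y
    rw [inv_mul_cancel_right, ← h y] at h1
    exact (mul_right_cancel₀ (jac_pos o ξ y).ne' (h1.symm.trans (one_mul _).symm))

end Orientation

/-! ### The measure of a top form agrees with |ρ| dy in every chart. -/

section FormMeasure

variable {n : ℕ} {M : Type*} [TopologicalSpace M] [ChartedSpace (Model n) M]
  [MeasurableSpace M] [BorelSpace M]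

-- Inverse charts are continuous only on their targets, so preimages under them must be cut down to
-- the target.
omit [ChartedSpace (Model n) M] in
theorem measurableSet_inter_preimage_of_continuousOn {ψ : Model n → M} {s : Set (Model n)}
    (hs : MeasurableSet s) (hψ : ContinuousOn ψ s) {A : Set M} (hA : MeasurableSet A) :
    MeasurableSet (s ∩ ψ ⁻¹' A) := by
  have h := (continuousOn_iff_continuous_domRestrict.1 hψ).measurable hA
  have h2 := hs.subtype_image h
  convert h2 using 1
  ext y
  simp [and_comm]

omit [MeasurableSpace M] [BorelSpace M] in
theorem measurableSet_chart_target (p : M) : MeasurableSet (extChartAt (𝓡 n) p).target :=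
  (isOpen_extChartAt_target p).measurableSet

theorem measurableSet_chart_source (p : M) : MeasurableSet (extChartAt (𝓡 n) p).source :=
  (isOpen_extChartAt_source p).measurableSet

theorem aemeasurable_chart_symm (α : TopForm n M) (p : M) :
    AEMeasurable (extChartAt (𝓡 n) p).symm
      (((volume : Measure (Model n)).restrict (extChartAt (𝓡 n) p).target).withDensity
        (fun y => ENNReal.ofReal |chartCoeff α p y|)) :=
  ((continuousOn_extChartAt_symm p).aemeasurable (measurableSet_chart_target p)).mono_ac
    (withDensity_absolutelyContinuous _ _)

theorem chartMeasure_apply (α : TopForm n M) (p : M) {A : Set M} (hA : MeasurableSet A) :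
    chartMeasure α p A = ∫⁻ y in (extChartAt (𝓡 n) p).target ∩ (extChartAt (𝓡 n) p).symm ⁻¹' A,
      ENNReal.ofReal |chartCoeff α p y| := by
  rw [chartMeasure, Measure.map_apply_of_aemeasurable (aemeasurable_chart_symm α p) hA,
    withDensity_apply', Measure.restrict_restrict' (measurableSet_chart_target p), Set.inter_comm]

theorem chartMeasure_inter_source (α : TopForm n M) (p : M) {A : Set M} (hA : MeasurableSet A) :
    chartMeasure α p (A ∩ (extChartAt (𝓡 n) p).source) = chartMeasure α p A := by
  rw [chartMeasure_apply α p hA, chartMeasure_apply α p (hA.inter (measurableSet_chart_source p))]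
  congr 2
  ext y
  constructor
  · rintro ⟨h1, h2⟩
    exact ⟨h1, h2.1⟩
  · rintro ⟨h1, h2⟩
    exact ⟨h1, h2, (extChartAt (𝓡 n) p).map_target h1⟩

variable [IsManifold (𝓡 n) ∞ M]

/-- The measure of a form in one chart, computed by the parametrisation `ξ ∘ φ⁻¹`. -/
theorem chartMeasure_eq_lintegral_paramCoeff (α : TopForm n M) (ξ : M ≃ₘ^∞⟮𝓡 n, 𝓡 n⟯ M) (p q : M)
    {A : Set M} (hA : MeasurableSet A) (hAq : A ⊆ (extChartAt (𝓡 n) q).source)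
    (hAp : ξ ⁻¹' A ⊆ (extChartAt (𝓡 n) p).source) :
    chartMeasure α q A =
      ∫⁻ y in (extChartAt (𝓡 n) p).target ∩ (fun y => ξ ((extChartAt (𝓡 n) p).symm y)) ⁻¹' A,
        ENNReal.ofReal |paramCoeff α (fun y => ξ ((extChartAt (𝓡 n) p).symm y)) y| := by
  set ψ : Model n → M := fun y => ξ ((extChartAt (𝓡 n) p).symm y) with hψ
  set σ : Model n → Model n := fun y => extChartAt (𝓡 n) q (ψ y) with hσ
  have hψd : ∀ y ∈ (extChartAt (𝓡 n) p).target, MDifferentiableAt (𝓡 n) (𝓡 n) ψ y :=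
    fun y hy => (diffeo_mdiff ξ _).comp (I' := 𝓡 n) y (mdiffAt_chart_symm hy)
  have hψc : ContinuousOn ψ (extChartAt (𝓡 n) p).target :=
    fun y hy => (hψd y hy).continuousAt.continuousWithinAt
  have hmeas := measurableSet_inter_preimage_of_continuousOn (measurableSet_chart_target p) hψc hA
  -- The chart image of A is the image under σ of its parameter set, and σ is injective there; the
  -- Euclidean change of variables then produces |det Dσ|, the factor relating the two coefficients.
  have himg : (extChartAt (𝓡 n) q).target ∩ (extChartAt (𝓡 n) q).symm ⁻¹' A =
      σ '' ((extChartAt (𝓡 n) p).target ∩ ψ ⁻¹' A) := by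
    ext z
    constructor
    · rintro ⟨hz, hzA⟩
      have h1 : ξ (ξ.symm ((extChartAt (𝓡 n) q).symm z)) = (extChartAt (𝓡 n) q).symm z :=
        ξ.apply_symm_apply _
      have h2 : ξ.symm ((extChartAt (𝓡 n) q).symm z) ∈ (extChartAt (𝓡 n) p).source :=
        hAp (by rw [Set.mem_preimage, h1]; exact hzA)
      have h3 : ψ (extChartAt (𝓡 n) p (ξ.symm ((extChartAt (𝓡 n) q).symm z))) =
          (extChartAt (𝓡 n) q).symm z := by
        simp only [hψ]
        rw [(extChartAt (𝓡 n) p).left_inv h2, h1]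
      refine ⟨extChartAt (𝓡 n) p (ξ.symm ((extChartAt (𝓡 n) q).symm z)),
        ⟨(extChartAt (𝓡 n) p).map_source h2, ?_⟩, ?_⟩
      · rw [Set.mem_preimage, h3]
        exact hzA
      · simp only [hσ]
        rw [h3, (extChartAt (𝓡 n) q).right_inv hz]
    · rintro ⟨y, ⟨-, hy2⟩, rfl⟩
      refine ⟨(extChartAt (𝓡 n) q).map_source (hAq hy2), ?_⟩
      simp only [Set.mem_preimage, hσ]
      rw [(extChartAt (𝓡 n) q).left_inv (hAq hy2)]
      exact hy2
  have hinj : Set.InjOn σ ((extChartAt (𝓡 n) p).target ∩ ψ ⁻¹' A) := by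
    rintro y ⟨hy1, hy2⟩ z ⟨hz1, hz2⟩ hyz
    have h1 := (extChartAt (𝓡 n) q).injOn (hAq hy2) (hAq hz2) hyz
    have h2 := ξ.injective h1
    exact (extChartAt (𝓡 n) p).symm.injOn hy1 hz1 h2
  have hder : ∀ y ∈ (extChartAt (𝓡 n) p).target ∩ ψ ⁻¹' A,
      HasFDerivWithinAt σ (fderiv ℝ σ y) ((extChartAt (𝓡 n) p).target ∩ ψ ⁻¹' A) y := by
    rintro y ⟨hy1, hy2⟩
    have h1 : MDifferentiableAt (𝓡 n) (𝓡 n) σ y :=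
      (mdiffAt_chart (hAq hy2)).comp (I' := 𝓡 n) y (hψd y hy1)
    exact (mdifferentiableAt_iff_differentiableAt.1 h1).hasFDerivAt.hasFDerivWithinAt
  rw [chartMeasure_apply α q hA, himg,
    lintegral_image_eq_lintegral_abs_det_fderiv_mul volume hmeas hder hinj]
  refine setLIntegral_congr_fun hmeas ?_
  rintro y ⟨hy1, hy2⟩
  simp only
  rw [paramCoeff_eq_det_mul α (hψd y hy1) (hAq hy2), abs_mul, ENNReal.ofReal_mul (abs_nonneg _)]

theorem chartMeasure_eq_chartMeasure (α : TopForm n M) (p q : M)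
    {A : Set M} (hA : MeasurableSet A) (hAq : A ⊆ (extChartAt (𝓡 n) q).source)
    (hAp : A ⊆ (extChartAt (𝓡 n) p).source) : chartMeasure α q A = chartMeasure α p A := by
  rw [chartMeasure_apply α p hA]
  exact chartMeasure_eq_lintegral_paramCoeff α (Diffeomorph.refl (𝓡 n) M ∞) p q hA hAq hAp

/-- The measure of a form is given by its coefficient in every chart. -/
theorem formMeasure_restrict_source (α : TopForm n M) (q : M) :
    (formMeasure α).restrict (extChartAt (𝓡 n) q).source = chartMeasure α q := by
  have hq := measurableSet_chart_source (n := n) q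
  -- Each chart measure is split along the source of `q`. Inside, it agrees with the measure of `q`
  -- on the overlap; outside, it is bounded by the supremum itself. On sets inside the source the
  -- second term vanishes.
  have h1 : formMeasure α ≤
      chartMeasure α q + (formMeasure α).restrict (extChartAt (𝓡 n) q).sourceᶜ := by
    refine iSup_le fun p => ?_
    rw [← Measure.restrict_add_restrict_compl (μ := chartMeasure α p) hq]
    refine add_le_add ?_ (Measure.restrict_mono le_rfl (le_iSup (chartMeasure α) p))
    refine Measure.le_iff.2 fun A hA => ?_
    rw [Measure.restrict_apply hA, ← chartMeasure_inter_source α p (hA.inter hq),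
      ← chartMeasure_eq_chartMeasure α p q
        ((hA.inter hq).inter (measurableSet_chart_source p))
        (fun x hx => hx.1.2) (fun x hx => hx.2)]
    exact measure_mono fun x hx => hx.1.1
  refine le_antisymm ?_ ?_
  · refine Measure.le_iff.2 fun A hA => ?_
    rw [Measure.restrict_apply hA]
    refine (h1 _).trans ?_
    rw [Measure.add_apply, Measure.restrict_apply (hA.inter hq)]
    have : A ∩ (extChartAt (𝓡 n) q).source ∩ (extChartAt (𝓡 n) q).sourceᶜ = ∅ := by
      ext x
      simp
    rw [this, measure_empty, add_zero]
    exact measure_mono Set.inter_subset_left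
  · refine Measure.le_iff.2 fun A hA => ?_
    rw [← chartMeasure_inter_source α q hA, Measure.restrict_apply hA]
    exact le_iSup (chartMeasure α) q _

theorem formMeasure_eq_chartMeasure (α : TopForm n M) (q : M) {A : Set M}
    (hAq : A ⊆ (extChartAt (𝓡 n) q).source) : formMeasure α A = chartMeasure α q A := by
  rw [← formMeasure_restrict_source α q, Measure.restrict_apply' (measurableSet_chart_source q),
    Set.inter_eq_left.2 hAq]

end FormMeasure

/-! ### The Riemannian measure and change of variables under diffeomorphisms. -/

section Volume

variable {n : ℕ} {M : Type*} [TopologicalSpace M] [ChartedSpace (Model n) M]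
  [MeasurableSpace M] [BorelSpace M]
  [IsManifold (𝓡 n) ∞ M] [RiemannianBundle (fun x : M => TangentSpace (𝓡 n) x)]
  [IsContMDiffRiemannianBundle (𝓡 n) ∞ (Model n) (fun x : M => TangentSpace (𝓡 n) x)]

omit [MeasurableSpace M] [BorelSpace M] in
theorem continuousOn_chartCoeff_volForm (o : ManifoldOrientation n M) (p : M) :
    ContinuousOn (chartCoeff (volForm o) p) (extChartAt (𝓡 n) p).target :=
  fun _ hy => (chartCoeff_volForm_contDiffAt o hy).continuousAt.continuousWithinAt

omit [MeasurableSpace M] [BorelSpace M] in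
theorem aemeasurable_chartCoeff_volForm (o : ManifoldOrientation n M) (p : M) :
    AEMeasurable (fun y => ENNReal.ofReal |chartCoeff (volForm o) p y|)
      ((volume : Measure (Model n)).restrict (extChartAt (𝓡 n) p).target) :=
  ((continuousOn_chartCoeff_volForm o p).abs.aemeasurable
    (isOpen_extChartAt_target p).measurableSet).ennreal_ofReal

theorem lintegral_vol_source (o : ManifoldOrientation n M) (p : M) {g : M → ENNReal}
    (hg : Measurable g) :
    ∫⁻ x in (extChartAt (𝓡 n) p).source, g x ∂(vol o) =
      ∫⁻ y in (extChartAt (𝓡 n) p).target,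
        ENNReal.ofReal |chartCoeff (volForm o) p y| * g ((extChartAt (𝓡 n) p).symm y) := by
  rw [vol, formMeasure_restrict_source, chartMeasure,
    lintegral_map' hg.aemeasurable (aemeasurable_chart_symm _ p),
    lintegral_withDensity_eq_lintegral_mul₀ (aemeasurable_chartCoeff_volForm o p)]
  · rfl
  · exact hg.comp_aemeasurable ((continuousOn_extChartAt_symm p).aemeasurable
      (measurableSet_chart_target p))

theorem integral_vol_source (o : ManifoldOrientation n M) (p : M) {g : M → ℝ}
    (hg : Measurable g) :
    ∫ x in (extChartAt (𝓡 n) p).source, g x ∂(vol o) =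
      ∫ y in (extChartAt (𝓡 n) p).target,
        |chartCoeff (volForm o) p y| * g ((extChartAt (𝓡 n) p).symm y) := by
  rw [vol, formMeasure_restrict_source, chartMeasure,
    integral_map (aemeasurable_chart_symm _ p) hg.aestronglyMeasurable,
    integral_withDensity_eq_integral_toReal_smul₀ (aemeasurable_chartCoeff_volForm o p)
      (by simp)]
  simp [ENNReal.toReal_ofReal, abs_nonneg]

/-- As ρ never vanishes, a null open set would have a Lebesgue null preimage in a chart, which is
nevertheless open and nonempty. -/
theorem vol_pos_of_isOpen (o : ManifoldOrientation n M) {U : Set M} (hU : IsOpen U)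
    (hne : U.Nonempty) : vol o U ≠ 0 := by
  obtain ⟨p, hp⟩ := hne
  intro h0
  have hUm := hU.inter (isOpen_extChartAt_source (I := 𝓡 n) p)
  have h1 : chartMeasure (volForm o) p (U ∩ (extChartAt (𝓡 n) p).source) = 0 := by
    rw [← formMeasure_eq_chartMeasure _ _ Set.inter_subset_right]
    exact measure_mono_null Set.inter_subset_left h0
  rw [chartMeasure_inter_source _ _ hU.measurableSet, chartMeasure_apply _ _ hU.measurableSet] at h1
  have hO := (continuousOn_extChartAt_symm (I := 𝓡 n) p).isOpen_inter_preimage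
    (isOpen_extChartAt_target p) hU
  rw [lintegral_eq_zero_iff' ((aemeasurable_chartCoeff_volForm o p).mono_measure
    (Measure.restrict_mono Set.inter_subset_left le_rfl))] at h1
  have h2 : ∀ᵐ y ∂((volume : Measure (Model n)).restrict
      ((extChartAt (𝓡 n) p).target ∩ (extChartAt (𝓡 n) p).symm ⁻¹' U)), False := by
    filter_upwards [h1, ae_restrict_mem hO.measurableSet] with y hy hy'
    have h3 := chartCoeff_volForm_ne_zero o hy'.1
    simp only [Pi.zero_apply, ENNReal.ofReal_eq_zero] at hy
    exact h3 (abs_nonpos_iff.1 hy)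
  have h4 : (volume : Measure (Model n))
      ((extChartAt (𝓡 n) p).target ∩ (extChartAt (𝓡 n) p).symm ⁻¹' U) = 0 := by
    simpa using h2
  refine hO.measure_ne_zero volume ?_ h4
  refine ⟨extChartAt (𝓡 n) p p, mem_extChartAt_target p, ?_⟩
  rw [Set.mem_preimage, extChartAt_to_inv]
  exact hp

theorem isOpenPosMeasure_vol (o : ManifoldOrientation n M) : (vol o).IsOpenPosMeasure :=
  ⟨fun _ hU hne => vol_pos_of_isOpen o hU hne⟩

omit [MeasurableSpace M] [BorelSpace M] in
theorem contMDiff_jac_diff (o : ManifoldOrientation n M) (ξ : M ≃ₘ^∞⟮𝓡 n, 𝓡 n⟯ M) :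
    ContMDiff (𝓡 n) 𝓘(ℝ, ℝ) ∞ (jac o ξ) := by
  intro x
  have h1 : ContMDiffAt (𝓘(ℝ, ℝ).prod (𝓡 n)) (𝓡 n) ∞ (fun r : ℝ × M => ξ r.2) (0, x) :=
    ξ.contMDiff.contMDiffAt.comp (0, x) contMDiffAt_snd
  have h2 := contMDiffAt_jac o (F := fun _ => ξ) h1
  exact ContMDiffAt.comp (f := fun z : M => ((0 : ℝ), z)) x h2
    (contMDiffAt_const.prodMk contMDiffAt_id)

/-- The change of variables formula for diffeomorphisms, on small sets. -/
theorem vol_eq_lintegral_jac (o : ManifoldOrientation n M) (ξ : M ≃ₘ^∞⟮𝓡 n, 𝓡 n⟯ M) (p q : M)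
    {A : Set M} (hA : MeasurableSet A) (hAq : A ⊆ (extChartAt (𝓡 n) q).source)
    (hAp : ξ ⁻¹' A ⊆ (extChartAt (𝓡 n) p).source) :
    vol o A = ∫⁻ x in ξ ⁻¹' A, ENNReal.ofReal |jac o ξ x| ∂(vol o) := by
  have hjm : Measurable (fun x => ENNReal.ofReal |jac o ξ x|) :=
    (contMDiff_jac_diff o ξ).continuous.abs.measurable.ennreal_ofReal
  have hξA : MeasurableSet (ξ ⁻¹' A) := ξ.continuous.measurable hA
  rw [vol, formMeasure_eq_chartMeasure _ _ hAq, ← vol,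
    chartMeasure_eq_lintegral_paramCoeff _ ξ p q hA hAq hAp]
  rw [← Set.inter_eq_left.2 hAp, ← Measure.restrict_restrict hξA, ← lintegral_indicator hξA,
    lintegral_vol_source o p (hjm.indicator hξA)]
  have hm := measurableSet_inter_preimage_of_continuousOn (measurableSet_chart_target (n := n) p)
    (continuousOn_extChartAt_symm (I := 𝓡 n) p) hξA
  have h1 : ∀ y ∈ (extChartAt (𝓡 n) p).target,
      ENNReal.ofReal |chartCoeff (volForm o) p y| *
        (ξ ⁻¹' A).indicator (fun x => ENNReal.ofReal |jac o ξ x|) ((extChartAt (𝓡 n) p).symm y) =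
      ((extChartAt (𝓡 n) p).target ∩ (extChartAt (𝓡 n) p).symm ⁻¹' (ξ ⁻¹' A)).indicator
        (fun y => ENNReal.ofReal
          |paramCoeff (volForm o) (fun y => ξ ((extChartAt (𝓡 n) p).symm y)) y|) y := by
    intro y hy
    by_cases hyA : (extChartAt (𝓡 n) p).symm y ∈ ξ ⁻¹' A
    · have hyA' : y ∈ (extChartAt (𝓡 n) p).target ∩
          (extChartAt (𝓡 n) p).symm ⁻¹' (ξ ⁻¹' A) := Set.mem_inter hy hyA
      rw [Set.indicator_of_mem hyA, Set.indicator_of_mem hyA',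
        ← chartCoeff_pullback _ _ hy (diffeo_mdiff ξ _), ← ENNReal.ofReal_mul (abs_nonneg _),
        ← abs_mul]
      rw [chartCoeff, chartCoeff, pullback_volForm, AlternatingMap.smul_apply, smul_eq_mul, mul_comm]
    · rw [Set.indicator_of_notMem hyA, Set.indicator_of_notMem (fun h => hyA h.2), mul_zero]
  rw [setLIntegral_congr_fun (measurableSet_chart_target p) h1, lintegral_indicator hm,
    Measure.restrict_restrict hm]
  congr 2
  ext y
  simp only [Set.mem_inter_iff, Set.mem_preimage]
  tauto

theorem vol_eq_map_withDensity_jac [CompactSpace M] (o : ManifoldOrientation n M)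
    (ξ : M ≃ₘ^∞⟮𝓡 n, 𝓡 n⟯ M) :
    ((vol o).withDensity (fun x => ENNReal.ofReal |jac o ξ x|)).map ξ = vol o := by
  -- On subsets of U x both the set and its preimage under ξ lie in a single chart, as the local
  -- formula requires. Finitely many U x cover the compact M, and measures agreeing on each of them
  -- are equal.
  let U : M → Set M := fun x =>
    ξ.symm ⁻¹' (extChartAt (𝓡 n) (ξ.symm x)).source ∩ (extChartAt (𝓡 n) x).source
  have hUo : ∀ x, IsOpen (U x) := fun x =>
    ((isOpen_extChartAt_source _).preimage ξ.symm.continuous).inter (isOpen_extChartAt_source x)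
  have hUx : ∀ x, x ∈ U x := fun x =>
    ⟨mem_extChartAt_source (I := 𝓡 n) (ξ.symm x), mem_extChartAt_source (I := 𝓡 n) x⟩
  obtain ⟨t, ht⟩ := CompactSpace.elim_nhds_subcover U fun x => (hUo x).mem_nhds (hUx x)
  have hcov : ⋃ x : t, U x = Set.univ := by
    refine Set.eq_univ_of_forall fun z => ?_
    obtain ⟨x, hx, hz⟩ := Set.mem_iUnion₂.1 (ht.ge (Set.mem_univ z))
    exact Set.mem_iUnion.2 ⟨⟨x, hx⟩, hz⟩
  refine (Measure.ext_iff_of_iUnion_eq_univ hcov).2 fun x => ?_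
  ext A hA
  rw [Measure.restrict_apply hA, Measure.restrict_apply hA]
  have hm := hA.inter (hUo x).measurableSet
  rw [Measure.map_apply ξ.continuous.measurable hm,
    withDensity_apply _ (ξ.continuous.measurable hm)]
  refine (vol_eq_lintegral_jac o ξ (ξ.symm x) x hm
    (Set.inter_subset_right.trans Set.inter_subset_right) (fun y hy => ?_)).symm
  have h1 := hy.2.1
  simpa using h1

end Volume

/-! ### The divergence theorem on `ℝⁿ`. -/

section Euclidean

variable {n : ℕ}

theorem integral_fderiv_apply_eq_zero {g : Model n → ℝ} (hg : ContDiff ℝ 1 g)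
    (hc : HasCompactSupport g) (e : Model n) : ∫ y, fderiv ℝ g y e = 0 := by
  have h1 : Integrable (fun y => fderiv ℝ g y e) :=
    ((hg.continuous_fderiv one_ne_zero).clm_apply continuous_const).integrable_of_hasCompactSupport
      (hc.fderiv_apply ℝ e)
  have h2 : Integrable g := hg.continuous.integrable_of_hasCompactSupport hc
  -- Integration by parts against the constant function 1.
  have h := integral_mul_fderiv_eq_neg_fderiv_mul_of_integrable (μ := (volume : Measure (Model n)))
    (f := fun _ => (1 : ℝ)) (g := g) (v := e) (by simp) (by simpa using h1)
    (by simpa using h2) (fun x _ => differentiableAt_const _)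
    (fun x _ => (hg.differentiable one_ne_zero) x)
  simpa using h

/-- The divergence theorem for compactly supported vector fields on `ℝⁿ`. -/
theorem integral_trace_fderiv_eq_zero {W : Model n → Model n} (hW : ContDiff ℝ 1 W)
    (hc : HasCompactSupport W) :
    ∫ y, LinearMap.trace ℝ (Model n) (fderiv ℝ W y).toLinearMap = 0 := by
  have h1 : ∀ y, LinearMap.trace ℝ (Model n) (fderiv ℝ W y).toLinearMap =
      ∑ i, fderiv ℝ (fun z => W z i) y (stdVec n i) := by
    intro y
    rw [LinearMap.trace_eq_matrix_trace ℝ (EuclideanSpace.basisFun (Fin n) ℝ).toBasis, Matrix.trace]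
    refine Finset.sum_congr rfl fun i _ => ?_
    have h2 : HasFDerivAt (fun z => W z i)
        ((EuclideanSpace.proj i : Model n →L[ℝ] ℝ).comp (fderiv ℝ W y)) y :=
      (EuclideanSpace.proj i : Model n →L[ℝ] ℝ).hasFDerivAt.comp y
        ((hW.differentiable one_ne_zero) y).hasFDerivAt
    rw [h2.fderiv, stdVec_eq_basis]
    simp [LinearMap.toMatrix_apply]
  have hWi : ∀ i, ContDiff ℝ 1 (fun z => W z i) := fun i =>
    (EuclideanSpace.proj i : Model n →L[ℝ] ℝ).contDiff.comp hW
  have hci : ∀ i, HasCompactSupport (fun z => W z i) := fun i =>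
    hc.comp_left (g := fun w : Model n => w i) rfl
  simp only [h1]
  rw [integral_finsetSum]
  · exact Finset.sum_eq_zero fun i _ => integral_fderiv_apply_eq_zero (hWi i) (hci i) _
  · intro i _
    exact (((hWi i).continuous_fderiv one_ne_zero).clm_apply
      continuous_const).integrable_of_hasCompactSupport ((hci i).fderiv_apply ℝ _)

end Euclidean

/-! ### The divergence theorem on a closed manifold. -/

section DivergenceTheorem

variable {n : ℕ} {M : Type*} [TopologicalSpace M] [ChartedSpace (Model n) M]
  [IsManifold (𝓡 n) ∞ M]

theorem chartComp_eq_zero (w : VField n M) {q : M} {y : Model n}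
    (hy : y ∈ (extChartAt (𝓡 n) q).target) (h : w ((extChartAt (𝓡 n) q).symm y) = 0) :
    chartComp w q y = 0 := by
  rw [chartComp_apply w hy, h]
  exact map_zero (mfderiv (𝓡 n) (𝓡 n) (extChartAt (𝓡 n) q) ((extChartAt (𝓡 n) q).symm y))

theorem divergence_eq_zero_of_eventually (μ : TopForm n M) (w : VField n M) {x : M}
    (h : ∀ᶠ z in 𝓝 x, w z = 0) : divergence μ w x = 0 := by
  have hc := (contMDiffAt_chart_symm (mem_extChartAt_target (I := 𝓡 n) x)).continuousAt.tendsto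
  rw [extChartAt_to_inv] at hc
  have h1 : chartComp w x =ᶠ[𝓝 (extChartAt (𝓡 n) x x)] fun _ => 0 := by
    filter_upwards [hc.eventually h, extChartAt_target_mem_nhds (I := 𝓡 n) x] with y hy hy'
    exact chartComp_eq_zero w hy' hy
  rw [divergence, h1.fderiv_eq, h1.self_of_nhds]
  simp

/-- The product of a smooth function and a smooth vector field. -/
def smulField (f : M → ℝ) (hf : ContMDiff (𝓡 n) 𝓘(ℝ, ℝ) ∞ f) (v : VField n M) : VField n M where
  toFun x := f x • v x
  contMDiff_toFun := hf.smul_section v.contMDiff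

theorem divergence_sum {ι : Type*} (μ : TopForm n M) (s : Finset ι) (v : ι → VField n M) (x : M) :
    divergence μ (∑ i ∈ s, v i) x = ∑ i ∈ s, divergence μ (v i) x := by
  classical
  induction s using Finset.induction_on with
  | empty =>
    simp only [Finset.sum_empty]
    exact (DivFree μ).zero_mem x
  | insert a s ha ih => rw [Finset.sum_insert ha, Finset.sum_insert ha, divergence_add, ih]

variable [CompactSpace M] [MeasurableSpace M] [BorelSpace M]
  [RiemannianBundle (fun x : M => TangentSpace (𝓡 n) x)]
  [IsContMDiffRiemannianBundle (𝓡 n) ∞ (Model n) (fun x : M => TangentSpace (𝓡 n) x)]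

/-- In the chart, |ρ| div w is the Euclidean divergence of |ρ| w. Since `w` vanishes off `K`, this
field extends by zero to a C¹ field of compact support on `ℝⁿ`. -/
theorem integral_divergence_eq_zero_of_support (o : ManifoldOrientation n M) (w : VField n M)
    (q : M) {K : Set M} (hK : IsClosed K) (hKq : K ⊆ (extChartAt (𝓡 n) q).source)
    (hw : ∀ x ∉ K, w x = 0) : ∫ x, divergence (volForm o) w x ∂(vol o) = 0 := by
  have hdiv : ∀ x ∉ K, divergence (volForm o) w x = 0 := fun x hx =>
    divergence_eq_zero_of_eventually _ w
      (Filter.eventually_of_mem (hK.isOpen_compl.mem_nhds hx) hw)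
  have h1 : ∫ x, divergence (volForm o) w x ∂(vol o) =
      ∫ x in (extChartAt (𝓡 n) q).source, divergence (volForm o) w x ∂(vol o) := by
    refine (setIntegral_eq_integral_of_forall_compl_eq_zero fun x hx => ?_).symm
    exact hdiv x fun h => hx (hKq h)
  rw [h1, integral_vol_source o q (continuous_divergence o w).measurable]
  set T := (extChartAt (𝓡 n) q).target with hT
  have hTo : IsOpen T := isOpen_extChartAt_target q
  set K' : Set (Model n) := extChartAt (𝓡 n) q '' K with hK'
  have hK'c : IsCompact K' :=
    hK.isCompact.image_of_continuousOn ((continuousOn_extChartAt q).mono hKq)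
  let W : Model n → Model n := T.indicator fun y => |chartCoeff (volForm o) q y| • chartComp w q y
  have hW0 : ∀ y ∉ K', W y = 0 := by
    intro y hy
    by_cases hyT : y ∈ T
    · have h2 : (extChartAt (𝓡 n) q).symm y ∉ K := fun h =>
        hy ⟨_, h, (extChartAt (𝓡 n) q).right_inv hyT⟩
      simp only [W]
      rw [Set.indicator_of_mem hyT, chartComp_eq_zero w hyT (hw _ h2), smul_zero]
    · exact Set.indicator_of_notMem hyT _
  have hWe : ∀ y ∈ T, W =ᶠ[𝓝 y] fun y => |chartCoeff (volForm o) q y| • chartComp w q y := by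
    intro y hy
    filter_upwards [hTo.mem_nhds hy] with z hz using Set.indicator_of_mem hz _
  have hW0e : ∀ y ∉ K', W =ᶠ[𝓝 y] fun _ => 0 := fun y hy =>
    Filter.eventually_of_mem (hK'c.isClosed.isOpen_compl.mem_nhds hy) hW0
  -- The measure has density |ρ| while the divergence involves ρ; the absolute value is harmless
  -- because ρ ≠ 0.
  have hρ : ∀ y ∈ T, ContDiffAt ℝ ∞ (fun y => |chartCoeff (volForm o) q y|) y := fun y hy =>
    (chartCoeff_volForm_contDiffAt o hy).abs (chartCoeff_volForm_ne_zero o hy)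
  have hWs : ContDiff ℝ 1 W := by
    rw [contDiff_iff_contDiffAt]
    intro y
    by_cases hy : y ∈ K'
    · have hyT : y ∈ T := by
        obtain ⟨x, hx, rfl⟩ := hy
        exact (extChartAt (𝓡 n) q).map_source (hKq hx)
      exact (((hρ y hyT).smul (chartComp_contDiffAt w hyT)).congr_of_eventuallyEq
        (hWe y hyT)).of_le (by simp)
    · exact contDiffAt_const.congr_of_eventuallyEq (hW0e y hy)
  have hWc : HasCompactSupport W := HasCompactSupport.intro hK'c hW0
  have h3 : ∀ y ∈ T, |chartCoeff (volForm o) q y| *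
      divergence (volForm o) w ((extChartAt (𝓡 n) q).symm y) =
        LinearMap.trace ℝ (Model n) (fderiv ℝ W y).toLinearMap := by
    intro y hy
    have hne := chartCoeff_volForm_ne_zero o hy
    have hV : HasFDerivAt (chartComp w q) (fderiv ℝ (chartComp w q) y) y :=
      ((chartComp_contDiffAt w hy).differentiableAt (by simp)).hasFDerivAt
    have hr : HasFDerivAt (chartCoeff (volForm o) q) (fderiv ℝ (chartCoeff (volForm o) q) y) y :=
      ((chartCoeff_volForm_contDiffAt o hy).differentiableAt (by simp)).hasFDerivAt
    have hd := ((hr.abs hne).smul hV).congr_of_eventuallyEq (hWe y hy)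
    rw [hd.fderiv, divergence_eq_chartDiv o w ((extChartAt (𝓡 n) q).map_target hy),
      (extChartAt (𝓡 n) q).right_inv hy, chartDiv]
    have htr : ∀ (L : Model n →L[ℝ] ℝ) (V : Model n),
        LinearMap.trace ℝ (Model n) (L.smulRight V).toLinearMap = L V := fun L V =>
      LinearMap.trace_smulRight L.toLinearMap V
    rw [ContinuousLinearMap.toLinearMap_add, map_add, ContinuousLinearMap.toLinearMap_smul, map_smul,
      htr]
    simp only [smul_eq_mul, smul_apply]
    rw [mul_add]
    congr 1
    rw [← sign_mul_self]
    field_simp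
  rw [setIntegral_congr_fun hTo.measurableSet h3, setIntegral_eq_integral_of_forall_compl_eq_zero,
    integral_trace_fderiv_eq_zero hWs hWc]
  intro y hy
  have hyK : y ∉ K' := by
    rintro ⟨x, hx, rfl⟩
    exact hy ((extChartAt (𝓡 n) q).map_source (hKq hx))
  rw [(hW0e y hyK).fderiv_eq]
  simp

/-- The divergence theorem on a closed manifold. -/
theorem integral_divergence_eq_zero [T2Space M] (o : ManifoldOrientation n M) [IsFiniteMeasure (vol o)]
    (v : VField n M) : ∫ x, divergence (volForm o) v x ∂(vol o) = 0 := by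
  obtain ⟨t, ht⟩ := CompactSpace.elim_nhds_subcover (fun x : M => (extChartAt (𝓡 n) x).source)
    fun x => extChartAt_source_mem_nhds (I := 𝓡 n) x
  obtain ⟨f, hf⟩ := SmoothPartitionOfUnity.exists_isSubordinate (𝓡 n) (isClosed_univ (X := M))
    (fun i : t => (extChartAt (𝓡 n) (i : M)).source)
    (fun i => isOpen_extChartAt_source (I := 𝓡 n) (i : M)) (fun z hz => by
      obtain ⟨x, hx, hz'⟩ := Set.mem_iUnion₂.1 (ht.ge hz)
      exact Set.mem_iUnion.2 ⟨⟨x, hx⟩, hz'⟩)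
  -- A partition of unity cuts `v` into fields supported in single charts; the divergence is
  -- additive.
  have hv : v = ∑ i : t, smulField (f i) (f i).contMDiff v := by
    ext x
    have h1 : ∑ i : t, f i x = 1 := by
      rw [← finsum_eq_sum_of_fintype]
      exact f.sum_eq_one (Set.mem_univ x)
    have h2 : (∑ i : t, smulField (f i) (f i).contMDiff v) x = ∑ i : t, f i x • v x := by
      rw [← ContMDiffSection.coeAddHom_apply, map_sum, Finset.sum_apply]
      rfl
    rw [h2, ← Finset.sum_smul, h1, one_smul]
  have h3 : ∀ x, divergence (volForm o) v x =
      ∑ i : t, divergence (volForm o) (smulField (f i) (f i).contMDiff v) x := by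
    intro x
    conv_lhs => rw [hv]
    exact divergence_sum _ _ _ x
  simp only [h3]
  rw [integral_finsetSum]
  · refine Finset.sum_eq_zero fun i _ => ?_
    refine integral_divergence_eq_zero_of_support o _ (i : M) (isClosed_tsupport (f i)) (hf i) ?_
    intro x hx
    have h4 : f i x = 0 := image_eq_zero_of_notMem_tsupport hx
    change f i x • v x = 0
    rw [h4, zero_smul]
  · intro i _
    exact (continuous_divergence o _).integrable_of_hasCompactSupport
      (HasCompactSupport.of_compactSpace _)

end DivergenceTheorem

/-! ### Smooth functions on `ℝ × M` as differentiable curves in `C(M, ℝ)`. -/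

section Curves

variable {n : ℕ} {M : Type*} [TopologicalSpace M] [ChartedSpace (Model n) M]
  [IsManifold (𝓡 n) ∞ M]

theorem hasDerivAt_and_continuousAt_deriv_fst {f : ℝ × M → ℝ}
    (hf : ContMDiff (𝓘(ℝ, ℝ).prod (𝓡 n)) 𝓘(ℝ, ℝ) ∞ f) (r : ℝ × M) :
    DifferentiableAt ℝ (fun s => f (s, r.2)) r.1 ∧
      ContinuousAt (fun r : ℝ × M => deriv (fun s => f (s, r.2)) r.1) r := by
  obtain ⟨t, x⟩ := r
  have hg : ∀ (s : ℝ) (y : Model n), y ∈ (extChartAt (𝓡 n) x).target →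
      ContDiffAt ℝ ∞ (fun w : ℝ × Model n => f (w.1, (extChartAt (𝓡 n) x).symm w.2)) (s, y) := by
    intro s y hy
    have h1 : ContMDiffAt (𝓘(ℝ, ℝ).prod (𝓡 n)) (𝓘(ℝ, ℝ).prod (𝓡 n)) ∞
        (fun r : ℝ × Model n => (r.1, (extChartAt (𝓡 n) x).symm r.2)) (s, y) :=
      contMDiffAt_fst.prodMk (ContMDiffAt.comp (s, y) (contMDiffAt_chart_symm hy) contMDiffAt_snd)
    have h2 := ContMDiffAt.comp (s, y) hf.contMDiffAt h1
    rw [← modelWithCornersSelf_prod, chartedSpaceSelf_prod] at h2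
    exact h2.contDiffAt
  set g : ℝ × Model n → ℝ := fun w => f (w.1, (extChartAt (𝓡 n) x).symm w.2) with hgdef
  have hd : ∀ (s : ℝ) (z : M), z ∈ (extChartAt (𝓡 n) x).source →
      HasDerivAt (fun s => f (s, z)) (fderiv ℝ g (s, extChartAt (𝓡 n) x z) (1, 0)) s := by
    intro s z hz
    have h1 := hasDerivAt_partial_fst
      ((hg s _ ((extChartAt (𝓡 n) x).map_source hz)).differentiableAt (by simp))
    have h2 : (fun s => g (s, extChartAt (𝓡 n) x z)) = fun s => f (s, z) := by
      funext s
      simp only [hgdef, (extChartAt (𝓡 n) x).left_inv hz]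
    rwa [h2] at h1
  refine ⟨(hd t x (mem_extChartAt_source x)).differentiableAt, ?_⟩
  have h1 : ContinuousAt (fderiv ℝ g) (t, extChartAt (𝓡 n) x x) :=
    ((hg t _ (mem_extChartAt_target x)).fderiv_right (m := ∞) (by simp)).continuousAt
  have h2 : ContinuousAt (fun r : ℝ × M => (r.1, extChartAt (𝓡 n) x r.2)) (t, x) :=
    continuousAt_fst.prodMk
      (ContinuousAt.comp (f := Prod.snd) (continuousAt_extChartAt x) continuousAt_snd)
  have h3 : ContinuousAt (fun r : ℝ × M => fderiv ℝ g (r.1, extChartAt (𝓡 n) x r.2) (1, 0))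
      (t, x) :=
    (ContinuousAt.comp (f := fun r : ℝ × M => (r.1, extChartAt (𝓡 n) x r.2)) h1 h2).clm_apply
      continuousAt_const
  refine h3.congr ?_
  have h4 : ∀ᶠ r : ℝ × M in 𝓝 (t, x), r.2 ∈ (extChartAt (𝓡 n) x).source :=
    continuousAt_snd.preimage_mem_nhds (extChartAt_source_mem_nhds (I := 𝓡 n) x)
  filter_upwards [h4] with r hr using (hd r.1 r.2 hr).deriv.symm

/-- A smooth function on `ℝ × M` defines a differentiable curve of continuous functions. -/
theorem hasDerivAt_continuousMap [CompactSpace M] {f : ℝ × M → ℝ}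
    (hf : ContMDiff (𝓘(ℝ, ℝ).prod (𝓡 n)) 𝓘(ℝ, ℝ) ∞ f) (c : ℝ → C(M, ℝ))
    (hc : ∀ s x, c s x = f (s, x)) (t : ℝ) (c' : C(M, ℝ))
    (hc' : ∀ x, HasDerivAt (fun s => f (s, x)) (c' x) t) : HasDerivAt c c' t := by
  have hcont : Continuous (fun r : ℝ × M => deriv (fun s => f (s, r.2)) r.1) :=
    continuous_iff_continuousAt.2 fun r => (hasDerivAt_and_continuousAt_deriv_fst hf r).2
  -- Joint continuity of the time derivative makes it a curve continuous in the sup norm. The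
  -- original curve is its integral, checked pointwise through evaluations, so the fundamental
  -- theorem of calculus in `C(M, ℝ)` upgrades pointwise to uniform differentiability.
  let g : C(ℝ, C(M, ℝ)) := ContinuousMap.curry ⟨_, hcont⟩
  have hg : ∀ s x, g s x = deriv (fun s => f (s, x)) s := fun _ _ => rfl
  have hint : ∀ a b, IntervalIntegrable g volume a b := fun a b => g.continuous.intervalIntegrable a b
  have h1 : HasDerivAt (fun s => c t + ∫ r in t..s, g r) (g t) t :=
    ((intervalIntegral.integral_hasDerivAt_right (hint t t)
      (g.continuous.stronglyMeasurableAtFilter _ _) g.continuous.continuousAt)).const_add _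
  have h2 : c = fun s => c t + ∫ r in t..s, g r := by
    funext s
    ext x
    have h3 := (ContinuousMap.evalCLM ℝ x).intervalIntegral_comp_comm (hint t s)
    simp only [ContinuousMap.evalCLM_apply] at h3
    rw [ContinuousMap.add_apply, ← h3]
    simp only [hg]
    rw [intervalIntegral.integral_deriv_eq_sub
      (fun r _ => (hasDerivAt_and_continuousAt_deriv_fst hf (r, x)).1), hc, hc]
    · ring
    · exact (hcont.comp (Continuous.prodMk_left x)).intervalIntegrable _ _
  have h4 : c' = g t := by
    ext x
    rw [hg, (hc' x).deriv]
  rw [h2, h4]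
  exact h1

end Curves

/-! ### The square root map, its differential and the isometry. -/

section SquareRoot

variable {n : ℕ} {M : Type*} [TopologicalSpace M] [CompactSpace M]
  [ChartedSpace (Model n) M] [IsManifold (𝓡 n) ∞ M] [MeasurableSpace M] [BorelSpace M]
  [RiemannianBundle (fun x : M => TangentSpace (𝓡 n) x)]
  [IsContMDiffRiemannianBundle (𝓡 n) ∞ (Model n) (fun x : M => TangentSpace (𝓡 n) x)]

/-- Positivity of J removes the absolute value from the change of variables formula. -/
theorem integral_comp_mul_jac (o : ManifoldOrientation n M) (ξ : Diff o) {g : M → ℝ}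
    (hg : Continuous g) :
    ∫ x, g ((ξ : M ≃ₘ^∞⟮𝓡 n, 𝓡 n⟯ M) x) * jac o (ξ : M ≃ₘ^∞⟮𝓡 n, 𝓡 n⟯ M) x ∂(vol o) =
      ∫ x, g x ∂(vol o) := by
  have hj : Measurable (fun x => ENNReal.ofReal |jac o (ξ : M ≃ₘ^∞⟮𝓡 n, 𝓡 n⟯ M) x|) :=
    (contMDiff_jac_diff o ξ).continuous.abs.measurable.ennreal_ofReal
  conv_rhs => rw [← vol_eq_map_withDensity_jac o (ξ : M ≃ₘ^∞⟮𝓡 n, 𝓡 n⟯ M)]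
  rw [integral_map (ξ : M ≃ₘ^∞⟮𝓡 n, 𝓡 n⟯ M).continuous.measurable.aemeasurable
      hg.measurable.aestronglyMeasurable,
    integral_withDensity_eq_integral_toReal_smul hj (by simp)]
  refine integral_congr_ae (Filter.Eventually.of_forall fun x => ?_)
  simp only [smul_eq_mul]
  rw [ENNReal.toReal_ofReal (abs_nonneg _), abs_of_pos (jac_pos o ξ x), mul_comm]

omit [CompactSpace M] [MeasurableSpace M] [BorelSpace M] in
theorem contMDiff_sqrt_jac (o : ManifoldOrientation n M) (ξ : Diff o) :
    ContMDiff (𝓡 n) 𝓘(ℝ, ℝ) ∞ (fun x => √(jac o (ξ : M ≃ₘ^∞⟮𝓡 n, 𝓡 n⟯ M) x)) := fun x =>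
  (Real.contDiffAt_sqrt (jac_pos o ξ x).ne').contMDiffAt.comp x (contMDiff_jac_diff o ξ x)

omit [CompactSpace M] [MeasurableSpace M] [BorelSpace M] in
theorem contMDiff_sqrt_jac_curve (o : ManifoldOrientation n M) {c : ℝ → Diff o}
    (hc : IsSmoothCurve c) : ContMDiff (𝓘(ℝ, ℝ).prod (𝓡 n)) 𝓘(ℝ, ℝ) ∞
      (fun p : ℝ × M => √(jac o (c p.1 : M ≃ₘ^∞⟮𝓡 n, 𝓡 n⟯ M) p.2)) := fun p =>
  (Real.contDiffAt_sqrt (jac_pos o (c p.1) p.2).ne').contMDiffAt.comp p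
    (contMDiffAt_jac o (F := fun s => (c s : M ≃ₘ^∞⟮𝓡 n, 𝓡 n⟯ M)) (hc p))

omit [CompactSpace M] [MeasurableSpace M] [BorelSpace M] in
theorem hasDerivAt_jac_curve (o : ManifoldOrientation n M) {c : ℝ → Diff o} {t : ℝ}
    {v : VField n M} (hc : IsSmoothCurve c) (hv : HasVelocity c t v) (x : M) :
    HasDerivAt (fun s => jac o (c s : M ≃ₘ^∞⟮𝓡 n, 𝓡 n⟯ M) x)
      (divergence (volForm o) v ((c t : M ≃ₘ^∞⟮𝓡 n, 𝓡 n⟯ M) x) *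
        jac o (c t : M ≃ₘ^∞⟮𝓡 n, 𝓡 n⟯ M) x) t :=
  hasDerivAt_jac o (F := fun s => (c s : M ≃ₘ^∞⟮𝓡 n, 𝓡 n⟯ M)) v (hc (t, x))
    (Filter.Eventually.of_forall hv)

omit [CompactSpace M] [MeasurableSpace M] [BorelSpace M] in
theorem hasDerivAt_sqrt_jac_curve (o : ManifoldOrientation n M) {c : ℝ → Diff o} {t : ℝ}
    {v : VField n M} (hc : IsSmoothCurve c) (hv : HasVelocity c t v) (x : M) :
    HasDerivAt (fun s => √(jac o (c s : M ≃ₘ^∞⟮𝓡 n, 𝓡 n⟯ M) x))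
      (1 / 2 * √(jac o (c t : M ≃ₘ^∞⟮𝓡 n, 𝓡 n⟯ M) x) *
        divergence (volForm o) v ((c t : M ≃ₘ^∞⟮𝓡 n, 𝓡 n⟯ M) x)) t := by
  have hp := jac_pos o (c t) x
  convert (hasDerivAt_jac_curve o hc hv x).sqrt hp.ne' using 1
  have hs := Real.sqrt_pos.2 hp
  have hss := Real.mul_self_sqrt hp.le
  field_simp
  rw [sq, hss, mul_comm]

omit [CompactSpace M] [MeasurableSpace M] [BorelSpace M] in
-- Curves through the same cosets have the same Jacobians, and by Liouville's formula div v ∘ c is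
-- the logarithmic time derivative of the Jacobian.
theorem divergence_comp_eq (o : ManifoldOrientation n M) {c₁ c₂ : ℝ → Diff o} {t : ℝ}
    {v₁ v₂ : VField n M} (hc₁ : IsSmoothCurve c₁) (hc₂ : IsSmoothCurve c₂)
    (h : ∀ s, Dens.proj o (c₁ s) = Dens.proj o (c₂ s))
    (hv₁ : HasVelocity c₁ t v₁) (hv₂ : HasVelocity c₂ t v₂) (x : M) :
    divergence (volForm o) v₁ ((c₁ t : M ≃ₘ^∞⟮𝓡 n, 𝓡 n⟯ M) x) =
      divergence (volForm o) v₂ ((c₂ t : M ≃ₘ^∞⟮𝓡 n, 𝓡 n⟯ M) x) := by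
  have h1 := hasDerivAt_jac_curve o hc₁ hv₁ x
  have h2 := hasDerivAt_jac_curve o hc₂ hv₂ x
  have h3 : ∀ s, jac o (c₁ s : M ≃ₘ^∞⟮𝓡 n, 𝓡 n⟯ M) x = jac o (c₂ s : M ≃ₘ^∞⟮𝓡 n, 𝓡 n⟯ M) x :=
    fun s => (proj_eq_iff_jac_eq o _ _).1 (h s) x
  simp only [h3] at h1
  exact mul_right_cancel₀ (jac_pos o (c₂ t) x).ne' (h1.unique h2)

/-- The divergences agree only after composition with the respective diffeomorphisms, so both
integrals are first pulled back, where their integrands, including the factor J, coincide. -/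
theorem hdot_eq_of_curves (o : ManifoldOrientation n M) {c₁ c₂ b₁ b₂ : ℝ → Diff o} {t : ℝ}
    {v₁ v₂ w₁ w₂ : VField n M} (hc₁ : IsSmoothCurve c₁) (hc₂ : IsSmoothCurve c₂)
    (hb₁ : IsSmoothCurve b₁) (hb₂ : IsSmoothCurve b₂)
    (hc : ∀ s, Dens.proj o (c₁ s) = Dens.proj o (c₂ s))
    (hb : ∀ s, Dens.proj o (b₁ s) = Dens.proj o (b₂ s)) (h₁ : c₁ t = b₁ t) (h₂ : c₂ t = b₂ t)
    (hv₁ : HasVelocity c₁ t v₁) (hv₂ : HasVelocity c₂ t v₂) (hw₁ : HasVelocity b₁ t w₁)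
    (hw₂ : HasVelocity b₂ t w₂) : hdot o v₁ w₁ = hdot o v₂ w₂ := by
  have hv := divergence_comp_eq o hc₁ hc₂ hc hv₁ hv₂
  have hw := divergence_comp_eq o hb₁ hb₂ hb hw₁ hw₂
  rw [← h₁, ← h₂] at hw
  have hj := (proj_eq_iff_jac_eq o _ _).1 (hc t)
  rw [hdot, hdot, ← integral_comp_mul_jac o (c₁ t)
      (g := fun x => divergence (volForm o) v₁ x * divergence (volForm o) w₁ x) ((continuous_divergence o v₁).mul (continuous_divergence o w₁)),
    ← integral_comp_mul_jac o (c₂ t)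
      (g := fun x => divergence (volForm o) v₂ x * divergence (volForm o) w₂ x) ((continuous_divergence o v₂).mul (continuous_divergence o w₂))]
  simp only [hv, hw, hj]

omit [CompactSpace M] [BorelSpace M]
  [IsContMDiffRiemannianBundle (𝓡 n) ∞ (Model n) (fun x : M => TangentSpace (𝓡 n) x)] in
theorem hdotDens_proj (o : ManifoldOrientation n M) (v w : VField n M) :
    hdotDens o (DensTangent.proj o v) (DensTangent.proj o w) = hdot o v w := rfl

theorem hdotDens_self_pos (o : ManifoldOrientation n M) [IsFiniteMeasure (vol o)]
    {X : DensTangent o} (hX : X ≠ 0) : 0 < hdotDens o X X := by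
  obtain ⟨v, rfl⟩ := Submodule.mkQ_surjective _ X
  rw [hdotDens_proj, hdot]
  have hv : ∃ x, divergence (volForm o) v x ≠ 0 := by
    by_contra! h
    exact hX ((Submodule.Quotient.mk_eq_zero _).2 h)
  obtain ⟨x, hx⟩ := hv
  have := isOpenPosMeasure_vol o
  have hc := continuous_divergence o v
  have hc2 : Continuous fun x => divergence (volForm o) v x * divergence (volForm o) v x :=
    hc.mul hc
  have h1 : 0 < ∫ x, divergence (volForm o) v x * divergence (volForm o) v x ∂(vol o) :=
    hc2.integral_pos_of_hasCompactSupport_nonneg_nonzero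
      (HasCompactSupport.of_compactSpace _) (fun _ => mul_self_nonneg _) (mul_self_ne_zero.2 hx)
  exact mul_pos (by norm_num) h1

/-- The square root of the Jacobian as a continuous function. -/
def sqrtJac (o : ManifoldOrientation n M) (ξ : Diff o) : C(M, ℝ) :=
  ⟨fun x => √(jac o (ξ : M ≃ₘ^∞⟮𝓡 n, 𝓡 n⟯ M) x), (contMDiff_sqrt_jac o ξ).continuous⟩

/-- The differential of the square root map as a map to continuous functions. -/
def dSqrtJac (o : ManifoldOrientation n M) (ξ : Diff o) : VField n M →ₗ[ℝ] C(M, ℝ) where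
  toFun v := ⟨fun x => 1 / 2 * √(jac o (ξ : M ≃ₘ^∞⟮𝓡 n, 𝓡 n⟯ M) x) *
      divergence (volForm o) v ((ξ : M ≃ₘ^∞⟮𝓡 n, 𝓡 n⟯ M) x),
    (continuous_const.mul (contMDiff_sqrt_jac o ξ).continuous).mul
      ((continuous_divergence o v).comp (ξ : M ≃ₘ^∞⟮𝓡 n, 𝓡 n⟯ M).continuous)⟩
  map_add' v w := by
    ext x
    simp only [ContinuousMap.coe_mk, ContinuousMap.add_apply, divergence_add]
    ring
  map_smul' a v := by
    ext x
    simp only [ContinuousMap.coe_mk, ContinuousMap.smul_apply, divergence_smul, RingHom.id_apply,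
      smul_eq_mul]
    ring

/-- The square root map `[ξ] ↦ √(Jac ξ)`. -/
def sqrtMap (o : ManifoldOrientation n M) [IsFiniteMeasure (vol o)] : Dens o → Lp ℝ 2 (vol o) :=
  Quotient.lift (fun ξ => ContinuousMap.toLp 2 (vol o) ℝ (sqrtJac o ξ)) fun ξ ζ h => by
    have h1 := (proj_eq_iff_jac_eq o ξ ζ).1 (Quotient.sound h)
    congr 1
    ext x
    simp only [sqrtJac, ContinuousMap.coe_mk, h1]

theorem sqrtMap_proj (o : ManifoldOrientation n M) [IsFiniteMeasure (vol o)] (ξ : Diff o) :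
    sqrtMap o (Dens.proj o ξ) = ContinuousMap.toLp 2 (vol o) ℝ (sqrtJac o ξ) := rfl

theorem sqrtMap_injective (o : ManifoldOrientation n M) [IsFiniteMeasure (vol o)] :
    Function.Injective (sqrtMap o) := by
  have := isOpenPosMeasure_vol o
  intro a b
  induction a using Quotient.ind with | _ ξ => ?_
  induction b using Quotient.ind with | _ ζ => ?_
  intro h
  -- Continuous functions equal almost everywhere are equal everywhere, since nonempty open sets
  -- have positive volume.
  have h1 : sqrtJac o ξ = sqrtJac o ζ := ContinuousMap.toLp_injective (vol o) h
  refine (proj_eq_iff_jac_eq o ξ ζ).2 fun x => ?_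
  have h2 := DFunLike.congr_fun h1 x
  exact (Real.sqrt_inj (jac_pos o ξ x).le (jac_pos o ζ x).le).1 h2

theorem norm_sqrtMap (o : ManifoldOrientation n M) [IsProbabilityMeasure (vol o)] (q : Dens o) :
    ‖sqrtMap o q‖ = 1 := by
  induction q using Quotient.ind with | _ ξ => ?_
  have h1 := integral_comp_mul_jac o ξ (g := fun _ => 1) continuous_const
  have h2 : inner ℝ (sqrtMap o (Dens.proj o ξ)) (sqrtMap o (Dens.proj o ξ)) = 1 := by
    rw [sqrtMap_proj, ContinuousMap.inner_toLp]
    simp only [one_mul, integral_const, probReal_univ, smul_eq_mul] at h1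
    rw [← h1]
    refine integral_congr_ae (Filter.Eventually.of_forall fun x => ?_)
    exact Real.mul_self_sqrt (jac_pos o ξ x).le
  rw [real_inner_self_eq_norm_sq] at h2
  exact (pow_eq_one_iff_of_nonneg (norm_nonneg _) two_ne_zero).1 h2

/-- The differential of the square root map. -/
def dSqrtMap (o : ManifoldOrientation n M) [IsFiniteMeasure (vol o)] (ξ : Diff o) :
    DensTangent o →ₗ[ℝ] Lp ℝ 2 (vol o) :=
  (DivFree (volForm o)).liftQ
    ((ContinuousMap.toLp 2 (vol o) ℝ).toLinearMap ∘ₗ dSqrtJac o ξ) fun v hv => by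
      have h : dSqrtJac o ξ v = 0 := by
        ext x
        exact mul_eq_zero_of_right _ (hv _)
      rw [LinearMap.mem_ker, LinearMap.comp_apply, h, map_zero]

theorem dSqrtMap_proj (o : ManifoldOrientation n M) [IsFiniteMeasure (vol o)] (ξ : Diff o)
    (v : VField n M) : dSqrtMap o ξ (DensTangent.proj o v) =
      ContinuousMap.toLp 2 (vol o) ℝ (dSqrtJac o ξ v) := rfl

/-- The derivative exists already in the sup norm, and the inclusion of `C(M, ℝ)` in L² is bounded
and linear. -/
theorem hasDerivAt_sqrtMap (o : ManifoldOrientation n M) [IsFiniteMeasure (vol o)]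
    {c : ℝ → Diff o} {t : ℝ} {v : VField n M} (hc : IsSmoothCurve c) (hv : HasVelocity c t v) :
    HasDerivAt (fun s => sqrtMap o (Dens.proj o (c s)))
      (dSqrtMap o (c t) (DensTangent.proj o v)) t := by
  have h1 : HasDerivAt (fun s => sqrtJac o (c s)) (dSqrtJac o (c t) v) t :=
    hasDerivAt_continuousMap (contMDiff_sqrt_jac_curve o hc) _ (fun _ _ => rfl) t _
      (hasDerivAt_sqrt_jac_curve o hc hv)
  exact (ContinuousMap.toLp 2 (vol o) ℝ).hasFDerivAt.comp_hasDerivAt t h1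

theorem inner_sqrtMap_dSqrtMap [T2Space M] (o : ManifoldOrientation n M) [IsFiniteMeasure (vol o)]
    (ξ : Diff o) (X : DensTangent o) :
    inner ℝ (sqrtMap o (Dens.proj o ξ)) (dSqrtMap o ξ X) = 0 := by
  obtain ⟨v, rfl⟩ := Submodule.mkQ_surjective _ X
  rw [sqrtMap_proj, dSqrtMap_proj, ContinuousMap.inner_toLp]
  have h1 := integral_comp_mul_jac o ξ (g := fun x => 1 / 2 * divergence (volForm o) v x)
    (continuous_const.mul (continuous_divergence o v))
  rw [integral_const_mul, integral_divergence_eq_zero, mul_zero] at h1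
  rw [← h1]
  refine integral_congr_ae (Filter.Eventually.of_forall fun x => ?_)
  have h2 := Real.mul_self_sqrt (jac_pos o ξ x).le
  simp only [sqrtJac, dSqrtJac, LinearMap.coe_mk, AddHom.coe_mk, ContinuousMap.coe_mk, conj_trivial]
  -- Every J becomes √J · √J, also those under a root; the next line restores the latter, and a
  -- polynomial identity in √J remains.
  rw [← h2]
  simp only [Real.sqrt_mul_self (Real.sqrt_nonneg _)]
  ring

theorem inner_dSqrtMap (o : ManifoldOrientation n M) [IsFiniteMeasure (vol o)]
    (ξ : Diff o) (X Y : DensTangent o) :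
    inner ℝ (dSqrtMap o ξ X) (dSqrtMap o ξ Y) = hdotDens o X Y := by
  obtain ⟨v, rfl⟩ := Submodule.mkQ_surjective _ X
  obtain ⟨w, rfl⟩ := Submodule.mkQ_surjective _ Y
  rw [dSqrtMap_proj, dSqrtMap_proj, ContinuousMap.inner_toLp, hdotDens_proj, hdot,
    ← integral_comp_mul_jac o ξ
      (g := fun x => divergence (volForm o) v x * divergence (volForm o) w x)
      ((continuous_divergence o v).mul (continuous_divergence o w)),
    ← integral_const_mul]
  refine integral_congr_ae (Filter.Eventually.of_forall fun x => ?_)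
  have h2 := Real.mul_self_sqrt (jac_pos o ξ x).le
  simp only [dSqrtJac, LinearMap.coe_mk, AddHom.coe_mk, ContinuousMap.coe_mk, conj_trivial]
  rw [← h2]
  simp only [Real.sqrt_mul_self (Real.sqrt_nonneg _)]
  ring

end SquareRoot

end SqrtMap

end

theorem mainTheorem3 {n : ℕ} {M : Type*} [TopologicalSpace M] [CompactSpace M] [T2Space M]
    [ChartedSpace (Model n) M] [IsManifold (𝓡 n) ∞ M]
    [RiemannianBundle (fun x : M => TangentSpace (𝓡 n) x)]
    [IsContMDiffRiemannianBundle (𝓡 n) ∞ (Model n) (fun x : M => TangentSpace (𝓡 n) x)]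
    [MeasurableSpace M] [BorelSpace M]
    (o : ManifoldOrientation n M) (hμ : vol o Set.univ = 1) :
    -- the square root of the Jacobian is defined, and it depends smoothly on the diffeomorphism
    (∀ (ξ : Diff o) (x : M), 0 < jac o (ξ : M ≃ₘ^∞⟮𝓡 n, 𝓡 n⟯ M) x) ∧
    (∀ c : ℝ → Diff o, IsSmoothCurve c →
      ContMDiff (𝓘(ℝ, ℝ).prod (𝓡 n)) 𝓘(ℝ, ℝ) ∞
        (fun p : ℝ × M => √(jac o (c p.1 : M ≃ₘ^∞⟮𝓡 n, 𝓡 n⟯ M) p.2))) ∧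
    -- the `Ḣ¹` metric is well defined and positive definite on the space of cosets
    (∀ (c₁ c₂ b₁ b₂ : ℝ → Diff o) (t : ℝ) (v₁ v₂ w₁ w₂ : VField n M),
      IsSmoothCurve c₁ → IsSmoothCurve c₂ → IsSmoothCurve b₁ → IsSmoothCurve b₂ →
      (∀ s, Dens.proj o (c₁ s) = Dens.proj o (c₂ s)) →
      (∀ s, Dens.proj o (b₁ s) = Dens.proj o (b₂ s)) →
      c₁ t = b₁ t → c₂ t = b₂ t →
      HasVelocity c₁ t v₁ → HasVelocity c₂ t v₂ → HasVelocity b₁ t w₁ → HasVelocity b₂ t w₂ →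
      hdot o v₁ w₁ = hdot o v₂ w₂) ∧
    (∀ X : DensTangent o, X ≠ 0 → 0 < hdotDens o X X) ∧
    -- the square root map on the space of cosets
    ∃ Ψ : Dens o → Lp ℝ 2 (vol o),
      (∀ ξ : Diff o, ContMDiff (𝓡 n) 𝓘(ℝ, ℝ) ∞
          (fun x => √(jac o (ξ : M ≃ₘ^∞⟮𝓡 n, 𝓡 n⟯ M) x)) ∧
        Ψ (Dens.proj o ξ) =ᵐ[vol o] fun x => √(jac o (ξ : M ≃ₘ^∞⟮𝓡 n, 𝓡 n⟯ M) x)) ∧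
      Function.Injective Ψ ∧
      (∀ q : Dens o, Ψ q ∈ Metric.sphere (0 : Lp ℝ 2 (vol o)) 1) ∧
      -- it has a differential at each coset, which takes the `Ḣ¹` metric to the `L²` metric
      ∀ ξ : Diff o, ∃ dΨ : DensTangent o →ₗ[ℝ] Lp ℝ 2 (vol o),
        (∀ (c : ℝ → Diff o) (t : ℝ) (v : VField n M),
          IsSmoothCurve c → c t = ξ → HasVelocity c t v →
          HasDerivAt (fun s => Ψ (Dens.proj o (c s))) (dΨ (DensTangent.proj o v)) t) ∧
        (∀ X : DensTangent o, inner ℝ (Ψ (Dens.proj o ξ)) (dΨ X) = 0) ∧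
        ∀ X Y : DensTangent o, inner ℝ (dΨ X) (dΨ Y) = hdotDens o X Y := by
  -- The normalisation provides the finiteness used for L² and for integrability; its exact value
  -- matters only for the unit norm.
  have hprob : IsProbabilityMeasure (vol o) := ⟨hμ⟩
  refine ⟨jac_pos o, fun c hc => contMDiff_sqrt_jac_curve o hc, ?_, fun X hX => hdotDens_self_pos o hX,
    sqrtMap o, fun ξ => ⟨contMDiff_sqrt_jac o ξ, ?_⟩, sqrtMap_injective o, fun q => ?_, fun ξ =>
    ⟨dSqrtMap o ξ, ?_, inner_sqrtMap_dSqrtMap o ξ, inner_dSqrtMap o ξ⟩⟩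
  · intro c₁ c₂ b₁ b₂ t v₁ v₂ w₁ w₂ hc₁ hc₂ hb₁ hb₂ hc hb h₁ h₂ hv₁ hv₂ hw₁ hw₂
    exact hdot_eq_of_curves o hc₁ hc₂ hb₁ hb₂ hc hb h₁ h₂ hv₁ hv₂ hw₁ hw₂
  · rw [sqrtMap_proj]
    exact ContinuousMap.coeFn_toLp (vol o) (sqrtJac o ξ)
  · rw [mem_sphere_zero_iff_norm, norm_sqrtMap]
  · rintro c t v hc rfl hv
    exact hasDerivAt_sqrtMap o hc hv
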